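/- A holomorphic foliation $\mathcal{F}$ of degree $n$ on $\mathbb{P}^2_{\mathbb{C}}$ is given by a $1$-form $\Omega_0=a\,dx+b\,dy+c\,dz$, where $a,b,c\in\mathbb{C}[x,y,z]$ are homogeneous of degree $n+1$, without common factor, and satisfy $xa+yb+zc=0$. For a line $\ell=\{F=0\}$, the pre-foliation $\ell\boxtimes\mathcal{F}$ of degree $n+1$ is given by the $1$-form $F\,\Omega_0$. The Legendre transform $\mathrm{Leg}\,\mathscr{F}$ of a foliation or pre-foliation $\mathscr{F}$ of degree $d\ge 1$, given by a form $\Omega$, is the $d$-web on the dual plane $\check{\mathbb{P}}^2_{\mathbb{C}}$ whose tangent directions at a generic line $L\in\check{\mathbb{P}}^2_{\mathbb{C}}$ are the directions of the pencils of lines through the $d$ points $m\in L$ at which $\Omega_m$ vanishes on $L$. For example, if $\Omega$ restricts to $f(x,y)(A(x,y)\,dx+B(x,y)\,dy)$ in the affine chart $z=1$, then $\mathrm{Leg}\,\mathscr{F}$ is described, in the chart $(p,q)\leftrightarrow\{y=px-q\}$, by $f(x,px-q)\,\bigl(A(x,px-q)+p\,B(x,px-q)\bigr)=0$ with $x=dq/dp$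 (a root at $x=\infty$ being counted as the foliation $dp=0$). If a $d$-web $\mathcal{W}$ is, near a point outside its discriminant $\Delta(\mathcal W)$ (that is, near a point where it is locally the superposition of $d$ pairwise transverse smooth foliations), the superposition of the foliations defined by the holomorphic $1$-forms $\omega_1,\dots,\omega_d$, write $\omega_i\wedge\omega_j=\delta_{ij}\,ds\wedge dt$ in local coordinates $(s,t)$, and let $\eta_{rst}$ $(r<s<t)$ be the unique $1$-form with $$d(\delta_{st}\omega_r)=\eta_{rst}\wedge\delta_{st}\omega_r,\quad d(\delta_{tr}\omega_s)=\eta_{rst}\wedge\delta_{tr}\omega_s,\quad d(\delta_{rs}\omega_t)=\eta_{rst}\wedge\delta_{rs}\omega_t .$$ The curvature of $\mathcal{W}$ is the $2$-form $K(\mathcal{W})=d\bigl(\sum_{r<s<t}\eta_{rst}\bigr)$; it does not depend on the choices made, and is meromorphic with poles along $\Delta(\mathcal W)$. The web $\mathcal{W}$ is flat if $K(\mathcal{W})\equiv 0$. **Theorem.** Let $d\ge 3$ be an integer and let $\mathcal{H}$ be a homogeneous foliation of degree $d-1$ on $\mathbb{P}^2_{\mathbb{C}}$, i.e. there is an affine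 chart $(x,y)$ of $\mathbb{P}^2_{\mathbb{C}}$ in which $\mathcal{H}$ is invariant under all homotheties $(x,y)\mapsto\lambda(x,y)$, $\lambda\in\mathbb{C}^*$. Let $L_\infty$ be the line at infinity of this chart. Then $$K\bigl(\mathrm{Leg}(L_\infty\boxtimes\mathcal{H})\bigr)=K\bigl(\mathrm{Leg}\,\mathcal{H}\bigr).$$ In particular, the $d$-web $\mathrm{Leg}(L_\infty\boxtimes\mathcal{H})$ is flat if and only if the $(d-1)$-web $\mathrm{Leg}\,\mathcal{H}$ is flat. Moreover, if $\mathcal{H}$ has degree $2$ (that is, $d=3$), then the $3$-web $\mathrm{Leg}(L_\infty\boxtimes\mathcal{H})$ is flat. -/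

import Mathlib

open scoped Matrix

noncomputable section

/-! ### Foliations and pre-foliations of the complex projective plane -/

/-- A holomorphic foliation of degree `n` on the projective plane, given in homogeneous coordinates
`X 0, X 1, X 2` by a `1`-form `∑ i, coeff i * d(X i)` whose coefficients are homogeneous polynomials
of degree `n + 1` without common factor satisfying the Euler condition. -/
structure PlaneFoliation (n : ℕ) where
  coeff : Fin 3 → MvPolynomial (Fin 3) ℂ
  homogeneous : ∀ i, (coeff i).IsHomogeneous (n + 1)
  euler : ∑ i, MvPolynomial.X i * coeff i = 0
  coprime : ∀ f : MvPolynomial (Fin 3) ℂ, (∀ i, f ∣ coeff i) → IsUnit f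

/-- A pre-foliation of co-degree `k` and degree `k + n`: a reduced curve of degree `k`
(given by a squarefree homogeneous equation) and a foliation of degree `n`. -/
structure PlanePreFoliation (k n : ℕ) where
  curve : MvPolynomial (Fin 3) ℂ
  curve_homogeneous : curve.IsHomogeneous k
  curve_squarefree : Squarefree curve
  foliation : PlaneFoliation n

/-- A foliation of degree `n`, seen as a pre-foliation of co-degree `0` (with empty curve). -/
def PlaneFoliation.toPre {n : ℕ} (F : PlaneFoliation n) : PlanePreFoliation 0 n where
  curve := 1
  curve_homogeneous := MvPolynomial.isHomogeneous_one _ _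
  curve_squarefree := squarefree_one
  foliation := F

/-- The value at the vector `x` of the `1`-form `f • Ω₀` defining a pre-foliation. -/
def PlanePreFoliation.formAt {k n : ℕ} (P : PlanePreFoliation k n) (x : Fin 3 → ℂ) : Fin 3 → ℂ :=
  fun i => MvPolynomial.eval x P.curve * MvPolynomial.eval x (P.foliation.coeff i)

/-! ### Homogeneous foliations

An affine chart of the projective plane is given by `g ∈ GL₃(ℂ)`: if `Y = g X`, the affine
coordinates are `(Y 0 / Y 2, Y 1 / Y 2)` and the line at infinity of the chart is `Y 2 = 0`. -/

/-- The linear form `∑ j, a j * X j`. -/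
def linearForm (a : Fin 3 → ℂ) : MvPolynomial (Fin 3) ℂ :=
  ∑ j, MvPolynomial.C (a j) * MvPolynomial.X j

/-- The pull-back of the `1`-form `∑ i, ω i * d(X i)` by the linear map `X ↦ φ X`. -/
def pullbackForm (φ : Matrix (Fin 3) (Fin 3) ℂ) (ω : Fin 3 → MvPolynomial (Fin 3) ℂ) :
    Fin 3 → MvPolynomial (Fin 3) ℂ :=
  fun j => ∑ i, MvPolynomial.C (φ i j) * MvPolynomial.bind₁ (fun k => linearForm (φ k)) (ω i)

/-- The homothety `(x, y) ↦ (c x, c y)` of the affine chart `g`, as a linear map in the homogeneous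
coordinates `X`. -/
def chartHomothety (g : GL (Fin 3) ℂ) (c : ℂ) : Matrix (Fin 3) (Fin 3) ℂ :=
  (g⁻¹ : GL (Fin 3) ℂ).1 * Matrix.diagonal ![c, c, 1] * g.1

/-- The foliation is homogeneous with respect to the affine chart `g`: it is invariant under all
the homotheties of this chart. -/
def PlaneFoliation.IsHomogeneousIn {n : ℕ} (F : PlaneFoliation n) (g : GL (Fin 3) ℂ) : Prop :=
  ∀ c : ℂ, c ≠ 0 → ∃ a : ℂ, a ≠ 0 ∧
    pullbackForm (chartHomothety g c) F.coeff = fun i => MvPolynomial.C a * F.coeff i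

theorem linearForm_isHomogeneous (a : Fin 3 → ℂ) : (linearForm a).IsHomogeneous 1 := by
  refine MvPolynomial.IsHomogeneous.sum _ _ _ fun j _ => ?_
  simpa using (MvPolynomial.isHomogeneous_C (Fin 3) (a j)).mul (MvPolynomial.isHomogeneous_X ℂ j)

theorem linearForm_ne_zero {a : Fin 3 → ℂ} (ha : a ≠ 0) : linearForm a ≠ 0 := by
  intro h
  apply ha
  funext i
  have := congrArg (MvPolynomial.eval (Pi.single i (1 : ℂ))) h
  simpa [linearForm, Pi.single_apply] using this

theorem linearForm_squarefree {a : Fin 3 → ℂ} (ha : a ≠ 0) : Squarefree (linearForm a) := by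
  rintro f ⟨r, hr⟩
  have h0 := linearForm_ne_zero ha
  have hdeg := (linearForm_isHomogeneous a).totalDegree h0
  have hff : f * f ≠ 0 := by rintro h; exact h0 (by rw [hr, h, zero_mul])
  have hf : f ≠ 0 := left_ne_zero_of_mul hff
  have hr0 : r ≠ 0 := by rintro rfl; exact h0 (by rw [hr, mul_zero])
  rw [hr, MvPolynomial.totalDegree_mul_of_isDomain hff hr0,
    MvPolynomial.totalDegree_mul_of_isDomain hf hf] at hdeg
  have hfd : f.totalDegree = 0 := by omega
  rw [MvPolynomial.totalDegree_eq_zero_iff_eq_C] at hfd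
  rw [hfd] at hf ⊢
  refine (IsUnit.mk0 _ ?_).map MvPolynomial.C
  intro h
  exact hf (by rw [h, map_zero])

theorem row_ne_zero (g : GL (Fin 3) ℂ) : g.1 2 ≠ 0 := by
  intro h
  have : g.1.det = 0 := Matrix.det_eq_zero_of_row_eq_zero 2 fun j => congrFun h j
  have hu := (Matrix.isUnit_iff_isUnit_det _).1 g.isUnit
  exact hu.ne_zero this

/-- The pre-foliation `L_∞ ⊠ F` of co-degree `1`, where `L_∞` is the line at infinity of the
affine chart `g`. -/
def PlaneFoliation.lineAtInfinityBox {n : ℕ} (F : PlaneFoliation n) (g : GL (Fin 3) ℂ) :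
    PlanePreFoliation 1 n where
  curve := linearForm (g.1 2)
  curve_homogeneous := linearForm_isHomogeneous _
  curve_squarefree := linearForm_squarefree (row_ne_zero g)
  foliation := F

/-! ### Webs on an open subset of `ℂ²` and their curvature

A `1`-form `a ds + b dt` on `ℂ²` is the function `z ↦ (a z, b z)`, a `2`-form `k ds ∧ dt` is the
function `k`. A web is given by its field of tangent directions. -/

/-- The coefficient of `ds ∧ dt` in the wedge product of two covectors. -/
def wedge (α β : ℂ × ℂ) : ℂ := α.1 * β.2 - α.2 * β.1

/-- The coefficient of `ds ∧ dt` in the exterior derivative of the `1`-form `ω`, at `z`. -/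
def extDer (ω : ℂ × ℂ → ℂ × ℂ) (z : ℂ × ℂ) : ℂ :=
  fderiv ℂ (fun w => (ω w).2) z (1, 0) - fderiv ℂ (fun w => (ω w).1) z (0, 1)

/-- On the open set `U`, the web with tangent directions `W` is the superposition
`F₁ ⊠ ⋯ ⊠ F_d` of `d` pairwise transverse smooth holomorphic foliations, the `i`-th one being
defined by the nowhere vanishing holomorphic `1`-form `ω i`. -/
structure IsDecomposition (d : ℕ) (W : ℂ × ℂ → Set (ℂ × ℂ)) (U : Set (ℂ × ℂ))
    (ω : Fin d → ℂ × ℂ → ℂ × ℂ) : Prop where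
  isOpen : IsOpen U
  analytic : ∀ i, AnalyticOnNhd ℂ (ω i) U
  ne_zero : ∀ i, ∀ z ∈ U, ω i z ≠ 0
  transverse : ∀ i j, i ≠ j → ∀ z ∈ U, wedge (ω i z) (ω j z) ≠ 0
  directions : ∀ z ∈ U, ∀ v : ℂ × ℂ, v ≠ 0 →
    (v ∈ W z ↔ ∃ i, (ω i z).1 * v.1 + (ω i z).2 * v.2 = 0)

/-- `z` is a regular point of the `d`-web `W`, i.e. `z` is not in the discriminant of `W`. -/
def IsRegularPoint (d : ℕ) (W : ℂ × ℂ → Set (ℂ × ℂ)) (z : ℂ × ℂ) : Prop :=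
  ∃ (U : Set (ℂ × ℂ)) (ω : Fin d → ℂ × ℂ → ℂ × ℂ), z ∈ U ∧ IsDecomposition d W U ω

/-- On `U`, `η` is the fundamental form of the `3`-web defined by `ω₁, ω₂, ω₃`. With
`δ_ij = wedge ω_i ω_j`, this means `d(δ₂₃ ω₁) = η ∧ δ₂₃ ω₁` and cyclically. -/
structure IsFundamentalForm (U : Set (ℂ × ℂ)) (ω₁ ω₂ ω₃ η : ℂ × ℂ → ℂ × ℂ) : Prop where
  analytic : AnalyticOnNhd ℂ η U
  eq₁ : ∀ z ∈ U, extDer (fun w => wedge (ω₂ w) (ω₃ w) • ω₁ w) z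
    = wedge (η z) (wedge (ω₂ z) (ω₃ z) • ω₁ z)
  eq₂ : ∀ z ∈ U, extDer (fun w => wedge (ω₃ w) (ω₁ w) • ω₂ w) z
    = wedge (η z) (wedge (ω₃ z) (ω₁ z) • ω₂ z)
  eq₃ : ∀ z ∈ U, extDer (fun w => wedge (ω₁ w) (ω₂ w) • ω₃ w) z
    = wedge (η z) (wedge (ω₁ z) (ω₂ z) • ω₃ z)

/-- The sum of the `1`-forms `η r s t` over `r < s < t`. -/
def tripleSum {d : ℕ} (η : Fin d → Fin d → Fin d → ℂ × ℂ → ℂ × ℂ) (z : ℂ × ℂ) : ℂ × ℂ :=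
  ∑ r, ∑ s, ∑ t, if r < s ∧ s < t then η r s t z else 0

/-- `κ` is the value at `z` of the curvature `d η(W)` of the `d`-web `W`, computed from a
decomposition of `W` near `z`, where `η(W)` is the sum of the fundamental forms of its
`3`-subwebs. -/
def HasCurvatureAt (d : ℕ) (W : ℂ × ℂ → Set (ℂ × ℂ)) (z : ℂ × ℂ) (κ : ℂ) : Prop :=
  ∃ (U : Set (ℂ × ℂ)) (ω : Fin d → ℂ × ℂ → ℂ × ℂ)
    (η : Fin d → Fin d → Fin d → ℂ × ℂ → ℂ × ℂ),
    z ∈ U ∧ IsDecomposition d W U ω ∧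
    (∀ r s t, r < s → s < t → IsFundamentalForm U (ω r) (ω s) (ω t) (η r s t)) ∧
    κ = extDer (tripleSum η) z

/-- The curvature of the `d`-web `W`, as the coefficient of `ds ∧ dt`. At a regular point it is the
value given by any local decomposition; elsewhere the value is irrelevant. -/
def webCurvature (d : ℕ) (W : ℂ × ℂ → Set (ℂ × ℂ)) (z : ℂ × ℂ) : ℂ :=
  Classical.epsilon (HasCurvatureAt d W z)

/-! ### The Legendre transform -/

/-- The Legendre transform of a pre-foliation of degree `k + n`, as a field of directions on the
dual plane, in the affine chart of the dual plane given by `h ∈ GL₃(ℂ)`.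

The point `z = (s, t)` of the chart is the line `u 0 * X 0 + u 1 * X 1 + u 2 * X 2 = 0` with
`u = h (s, t, 1)`. A direction `v ≠ 0` at `z` is a direction `u' = h (v, 0)` at this line; it is
the direction of the pencil of lines through the point `m = u ⨯₃ u'` of the line. It is tangent to
the Legendre transform when `m` is a point of the curve or a tangency point of the foliation with
the line, i.e. when the form of the pre-foliation at `m` is proportional to `u`. -/
def PlanePreFoliation.leg {k n : ℕ} (P : PlanePreFoliation k n) (h : GL (Fin 3) ℂ) (z : ℂ × ℂ) :
    Set (ℂ × ℂ) :=
  let u : Fin 3 → ℂ := h.1 *ᵥ ![z.1, z.2, 1]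
  {v | v ≠ 0 ∧ P.formAt (u ⨯₃ (h.1 *ᵥ ![v.1, v.2, 0])) ⨯₃ u = 0}

/-- In the chart `h` of the dual plane, the point `z` is outside the discriminant of the
`(k + n)`-web `Leg P`. -/
def PlanePreFoliation.LegRegularAt {k n : ℕ} (P : PlanePreFoliation k n) (h : GL (Fin 3) ℂ)
    (z : ℂ × ℂ) : Prop :=
  IsRegularPoint (k + n) (P.leg h) z

/-- The curvature `K(Leg P)` in the chart `h` of the dual plane. -/
def PlanePreFoliation.legCurvature {k n : ℕ} (P : PlanePreFoliation k n) (h : GL (Fin 3) ℂ)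
    (z : ℂ × ℂ) : ℂ :=
  webCurvature (k + n) (P.leg h) z

/-- The web `Leg P` is flat: its curvature vanishes identically (in every affine chart of the dual
plane, outside the discriminant). -/
def PlanePreFoliation.LegFlat {k n : ℕ} (P : PlanePreFoliation k n) : Prop :=
  ∀ (h : GL (Fin 3) ℂ) (z : ℂ × ℂ), P.LegRegularAt h z → P.legCurvature h z = 0

/-- `K(Leg P) = K(Leg Q)`: the two curvatures coincide, in every affine chart of the dual plane,
outside the two discriminants. -/
def SameLegCurvature {k n k' n' : ℕ} (P : PlanePreFoliation k n) (Q : PlanePreFoliation k' n') :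
    Prop :=
  ∀ (h : GL (Fin 3) ℂ) (z : ℂ × ℂ), P.LegRegularAt h z → Q.LegRegularAt h z →
    P.legCurvature h z = Q.legCurvature h z

end

/-! The pencil of parallel lines dual to `L_∞` contributes nothing to the curvature, because each
`3`-subweb containing it is flat.

In the affine chart write a line as σx + y + τ = 0. Homotheties fix the slope σ and rescale the
intercept τ, so for a homogeneous foliation the tangency points with this line have abscissae x = -τ
ξ(σ), where ξ runs over finitely many functions of σ alone. The pencil through a fixed point (x, y)
is x dσ + dτ = 0, so each foliation of `Leg H` is defined by θ - ξ α with θ = dτ/τ and α = dσ, and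
the pencil through the point at infinity of the line is α = 0. Since θ and α are closed and dξ ∧ α =
0, the normalized forms of a triple (θ - ξ₁ α, θ - ξ₂ α, α) become closed after division by one
common factor. Its fundamental form is thus a logarithmic differential and its curvature is zero
(`extDer_fundForm_eq_zero`, `extDer_fundForm_pencil`). Summing over triples leaves the curvature of
`Leg H`.

Three points need care. The curvature is defined through an arbitrary decomposition, so it must be
shown independent of that choice (`IsDecomposition.webCurvature_eq`). At a regular point of the
larger web, the pencil direction must be shown not to be a tangency direction of `H` as well:
otherwise a foliation of degree n would have n + 1 tangencies with a line it is not everywhere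
tangent to (`IsDecomposition.exists_pencil`). Finally σ and τ are coordinates only away from
vertical lines and lines through the origin; the remaining regular points, and the regular points of
`Leg H` that are singular for the larger web, are reached by density and continuity
(`dense_generic`, `IsDecomposition.dense_regular`). -/

open Filter Topology

noncomputable section

/-! ### Calculus of differential forms in two variables -/

/-- The differential of a function, as a `1`-form. -/
def dForm (f : ℂ × ℂ → ℂ) (z : ℂ × ℂ) : ℂ × ℂ := (fderiv ℂ f z (1, 0), fderiv ℂ f z (0, 1))

theorem AnalyticAt.prodFst {ω : ℂ × ℂ → ℂ × ℂ} {z : ℂ × ℂ} (h : AnalyticAt ℂ ω z) :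
    AnalyticAt ℂ (fun w => (ω w).1) z :=
  (analyticAt_fst (𝕜 := ℂ) (p := ω z)).comp h

theorem AnalyticAt.prodSnd {ω : ℂ × ℂ → ℂ × ℂ} {z : ℂ × ℂ} (h : AnalyticAt ℂ ω z) :
    AnalyticAt ℂ (fun w => (ω w).2) z :=
  (analyticAt_snd (𝕜 := ℂ) (p := ω z)).comp h

theorem AnalyticAt.fderiv_apply_const {f : ℂ × ℂ → ℂ} {z : ℂ × ℂ} (hf : AnalyticAt ℂ f z)
    (v : ℂ × ℂ) : AnalyticAt ℂ (fun w => fderiv ℂ f w v) z :=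
  ((ContinuousLinearMap.apply ℂ ℂ v).analyticAt _).comp hf.fderiv

theorem AnalyticAt.wedge {α β : ℂ × ℂ → ℂ × ℂ} {z : ℂ × ℂ} (hα : AnalyticAt ℂ α z)
    (hβ : AnalyticAt ℂ β z) : AnalyticAt ℂ (fun w => wedge (α w) (β w)) z :=
  (hα.prodFst.mul hβ.prodSnd).sub (hα.prodSnd.mul hβ.prodFst)

theorem AnalyticAt.dForm {f : ℂ × ℂ → ℂ} {z : ℂ × ℂ} (hf : AnalyticAt ℂ f z) :
    AnalyticAt ℂ (dForm f) z :=
  (hf.fderiv_apply_const _).prod (hf.fderiv_apply_const _)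

theorem AnalyticAt.extDer {ω : ℂ × ℂ → ℂ × ℂ} {z : ℂ × ℂ} (hω : AnalyticAt ℂ ω z) :
    AnalyticAt ℂ (extDer ω) z :=
  (hω.prodSnd.fderiv_apply_const _).sub (hω.prodFst.fderiv_apply_const _)

theorem fderiv_apply_eq_dForm (f : ℂ × ℂ → ℂ) (z v : ℂ × ℂ) :
    fderiv ℂ f z v = (dForm f z).1 * v.1 + (dForm f z).2 * v.2 := by
  have : v = v.1 • ((1, 0) : ℂ × ℂ) + v.2 • ((0, 1) : ℂ × ℂ) := by ext <;> simp
  conv_lhs => rw [this, map_add, map_smul, map_smul]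
  simp [dForm, mul_comm]

theorem extDer_congr {ω ω' : ℂ × ℂ → ℂ × ℂ} {z : ℂ × ℂ} (h : ω =ᶠ[𝓝 z] ω') :
    extDer ω z = extDer ω' z := by
  have h1 : (fun w => (ω w).1) =ᶠ[𝓝 z] fun w => (ω' w).1 := h.fun_comp Prod.fst
  have h2 : (fun w => (ω w).2) =ᶠ[𝓝 z] fun w => (ω' w).2 := h.fun_comp Prod.snd
  simp only [extDer, h1.fderiv_eq, h2.fderiv_eq]

theorem extDer_add {ω ω' : ℂ × ℂ → ℂ × ℂ} {z : ℂ × ℂ} (h : DifferentiableAt ℂ ω z)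
    (h' : DifferentiableAt ℂ ω' z) :
    extDer (fun w => ω w + ω' w) z = extDer ω z + extDer ω' z := by
  simp only [extDer, Prod.fst_add, Prod.snd_add]
  rw [fderiv_fun_add (by fun_prop) (by fun_prop), fderiv_fun_add (by fun_prop) (by fun_prop)]
  simp only [add_apply]
  ring

theorem extDer_zero (z : ℂ × ℂ) : extDer (fun _ => 0) z = 0 := by
  simp [extDer]

theorem extDer_neg (ω : ℂ × ℂ → ℂ × ℂ) (z : ℂ × ℂ) :
    extDer (fun w => -ω w) z = -extDer ω z := by
  simp only [extDer, Prod.fst_neg, Prod.snd_neg, fderiv_fun_neg]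
  simp only [neg_apply]
  ring

theorem extDer_sum {ι : Type*} (s : Finset ι) (ω : ι → ℂ × ℂ → ℂ × ℂ) {z : ℂ × ℂ}
    (h : ∀ i ∈ s, DifferentiableAt ℂ (ω i) z) :
    extDer (fun w => ∑ i ∈ s, ω i w) z = ∑ i ∈ s, extDer (ω i) z := by
  classical
  induction s using Finset.induction_on with
  | empty => simp [extDer_zero]
  | insert i s hi ih =>
    simp only [Finset.sum_insert hi]
    have hs : ∀ j ∈ s, DifferentiableAt ℂ (ω j) z := fun j hj =>
      h j (Finset.mem_insert_of_mem hj)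
    rw [extDer_add (h i (Finset.mem_insert_self _ _)) (by fun_prop (disch := assumption)), ih hs]

theorem extDer_smul {f : ℂ × ℂ → ℂ} {ω : ℂ × ℂ → ℂ × ℂ} {z : ℂ × ℂ}
    (hf : DifferentiableAt ℂ f z) (hω : DifferentiableAt ℂ ω z) :
    extDer (fun w => f w • ω w) z = wedge (dForm f z) (ω z) + f z * extDer ω z := by
  simp only [extDer, Prod.smul_fst, Prod.smul_snd, smul_eq_mul, wedge, dForm]
  rw [fderiv_fun_mul hf (by fun_prop), fderiv_fun_mul hf (by fun_prop)]
  simp only [add_apply, smul_apply, smul_eq_mul]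
  ring

/-- Symmetry of the second derivative. -/
theorem extDer_dForm {f : ℂ × ℂ → ℂ} {z : ℂ × ℂ} (hf : AnalyticAt ℂ f z) :
    extDer (dForm f) z = 0 := by
  have hs : IsSymmSndFDerivAt ℂ f z := by
    apply ContDiffAt.isSymmSndFDerivAt (n := 2) hf.contDiffAt
    simp
  have hd : DifferentiableAt ℂ (fderiv ℂ f) z := hf.fderiv.differentiableAt
  simp only [extDer, dForm]
  rw [fderiv_clm_apply hd (by fun_prop), fderiv_clm_apply hd (by fun_prop)]
  simpa [sub_eq_zero] using hs.eq (1, 0) (0, 1)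

theorem dForm_inv {f : ℂ × ℂ → ℂ} {z : ℂ × ℂ} (hf : DifferentiableAt ℂ f z) (h0 : f z ≠ 0) :
    dForm (fun w => (f w)⁻¹) z = -(f z ^ 2)⁻¹ • dForm f z := by
  have := ((hasDerivAt_inv h0).comp_hasFDerivAt z hf.hasFDerivAt).fderiv
  have e : (fun w => (f w)⁻¹) = Inv.inv ∘ f := rfl
  simp [dForm, e, this]

/-- A logarithmic differential is closed. -/
theorem extDer_dlog {f : ℂ × ℂ → ℂ} {z : ℂ × ℂ} (hf : AnalyticAt ℂ f z) (h0 : f z ≠ 0) :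
    extDer (fun w => (f w)⁻¹ • dForm f w) z = 0 := by
  rw [extDer_smul (f := fun w => (f w)⁻¹) (hf.differentiableAt.inv h0)
    hf.dForm.differentiableAt, extDer_dForm hf,
    dForm_inv hf.differentiableAt h0]
  simp only [wedge, Prod.smul_fst, Prod.smul_snd, smul_eq_mul]
  ring

/-- Covectors are determined by their wedge products with a basis. -/
theorem eq_of_wedge_eq {a b α β : ℂ × ℂ} (h : wedge a b ≠ 0) (ha : wedge α a = wedge β a)
    (hb : wedge α b = wedge β b) : α = β := by
  have key1 : wedge a b * (α.1 - β.1) = 0 := by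
    simp only [wedge] at *
    linear_combination a.1 * hb - b.1 * ha
  have key2 : wedge a b * (α.2 - β.2) = 0 := by
    simp only [wedge] at *
    linear_combination a.2 * hb - b.2 * ha
  ext
  · exact sub_eq_zero.1 ((mul_eq_zero.1 key1).resolve_left h)
  · exact sub_eq_zero.1 ((mul_eq_zero.1 key2).resolve_left h)

/-- If `η`, `η'` are the connection forms of `(Ω₁, Ω₂)` and `(f Ω₁, f Ω₂)`, then `dη' = dη`. -/
theorem extDer_eq_of_rescale {η η' Ω₁ Ω₂ : ℂ × ℂ → ℂ × ℂ} {f : ℂ × ℂ → ℂ} {z : ℂ × ℂ}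
    (hη : AnalyticAt ℂ η z) (hf : AnalyticAt ℂ f z) (hf0 : f z ≠ 0)
    (hΩ₁ : AnalyticAt ℂ Ω₁ z) (hΩ₂ : AnalyticAt ℂ Ω₂ z) (hw : wedge (Ω₁ z) (Ω₂ z) ≠ 0)
    (h₁ : ∀ᶠ w in 𝓝 z, extDer Ω₁ w = wedge (η w) (Ω₁ w))
    (h₂ : ∀ᶠ w in 𝓝 z, extDer Ω₂ w = wedge (η w) (Ω₂ w))
    (h₁' : ∀ᶠ w in 𝓝 z, extDer (fun w => f w • Ω₁ w) w = wedge (η' w) (f w • Ω₁ w))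
    (h₂' : ∀ᶠ w in 𝓝 z, extDer (fun w => f w • Ω₂ w) w = wedge (η' w) (f w • Ω₂ w)) :
    extDer η' z = extDer η z := by
  -- From d(f Ω) = (df/f + η) ∧ f Ω for two independent Ω, the forms η' and η differ by df/f, which
  -- is closed.
  have key : η' =ᶠ[𝓝 z] fun w => η w + (f w)⁻¹ • dForm f w := by
    filter_upwards [h₁, h₂, h₁', h₂', hf.eventually_analyticAt, hΩ₁.eventually_analyticAt,
      hΩ₂.eventually_analyticAt, hf.continuousAt.eventually_ne hf0,
      (hΩ₁.wedge hΩ₂).continuousAt.eventually_ne hw] with w e1 e2 e1' e2' af a1 a2 f0 w0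
    rw [extDer_smul af.differentiableAt a1.differentiableAt, e1] at e1'
    rw [extDer_smul af.differentiableAt a2.differentiableAt, e2] at e2'
    refine eq_of_wedge_eq w0 ?_ ?_
    · simp only [wedge, Prod.smul_fst, Prod.smul_snd, smul_eq_mul, Prod.fst_add,
        Prod.snd_add] at e1' ⊢
      field_simp
      linear_combination -e1'
    · simp only [wedge, Prod.smul_fst, Prod.smul_snd, smul_eq_mul, Prod.fst_add,
        Prod.snd_add] at e2' ⊢
      field_simp
      linear_combination -e2'
  rw [extDer_congr key, extDer_add hη.differentiableAt, extDer_dlog hf hf0, add_zero]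
  exact ((hf.inv hf0).smul hf.dForm).differentiableAt

/-! ### The fundamental form of a `3`-web -/

/-- The form `δ₂₃ ω₁`. -/
def normForm (ω₁ ω₂ ω₃ : ℂ × ℂ → ℂ × ℂ) (z : ℂ × ℂ) : ℂ × ℂ := wedge (ω₂ z) (ω₃ z) • ω₁ z

/-- The fundamental form of the `3`-web defined by `ω₁, ω₂, ω₃`. -/
def fundForm (ω₁ ω₂ ω₃ : ℂ × ℂ → ℂ × ℂ) (z : ℂ × ℂ) : ℂ × ℂ :=
  (wedge (normForm ω₁ ω₂ ω₃ z) (normForm ω₂ ω₃ ω₁ z))⁻¹ •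
    (extDer (normForm ω₂ ω₃ ω₁) z • normForm ω₁ ω₂ ω₃ z -
      extDer (normForm ω₁ ω₂ ω₃) z • normForm ω₂ ω₃ ω₁ z)

/-- The three forms are analytic and pairwise independent at `z`. -/
structure IsTransverseTriple (ω₁ ω₂ ω₃ : ℂ × ℂ → ℂ × ℂ) (z : ℂ × ℂ) : Prop where
  an₁ : AnalyticAt ℂ ω₁ z
  an₂ : AnalyticAt ℂ ω₂ z
  an₃ : AnalyticAt ℂ ω₃ z
  ne₁₂ : wedge (ω₁ z) (ω₂ z) ≠ 0
  ne₂₃ : wedge (ω₂ z) (ω₃ z) ≠ 0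
  ne₃₁ : wedge (ω₃ z) (ω₁ z) ≠ 0

theorem wedge_comm (α β : ℂ × ℂ) : wedge α β = -wedge β α := by
  simp only [wedge]; ring

theorem wedge_ne_zero_symm {α β : ℂ × ℂ} (h : wedge α β ≠ 0) : wedge β α ≠ 0 := by
  rw [wedge_comm]; exact neg_ne_zero.2 h

theorem normForm_swap (ω₁ ω₂ ω₃ : ℂ × ℂ → ℂ × ℂ) :
    normForm ω₁ ω₃ ω₂ = fun w => -normForm ω₁ ω₂ ω₃ w := by
  funext w
  simp only [normForm]
  rw [wedge_comm, neg_smul]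

theorem wedge_normForm (ω₁ ω₂ ω₃ : ℂ × ℂ → ℂ × ℂ) (z : ℂ × ℂ) :
    wedge (normForm ω₁ ω₂ ω₃ z) (normForm ω₂ ω₃ ω₁ z) =
      wedge (ω₁ z) (ω₂ z) * wedge (ω₂ z) (ω₃ z) * wedge (ω₃ z) (ω₁ z) := by
  simp only [normForm, wedge, Prod.smul_fst, Prod.smul_snd, smul_eq_mul]; ring

/-- Three covectors in a plane satisfy one linear relation, and the normalization makes its
coefficients all equal to 1. Hence two of the three equations defining the fundamental form imply
the third. -/
theorem normForm_third (ω₁ ω₂ ω₃ : ℂ × ℂ → ℂ × ℂ) :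
    normForm ω₃ ω₁ ω₂ = fun w => -(normForm ω₁ ω₂ ω₃ w + normForm ω₂ ω₃ ω₁ w) := by
  funext w
  ext <;>
  · simp only [normForm, wedge, Prod.smul_fst, Prod.smul_snd, smul_eq_mul, Prod.fst_neg,
      Prod.snd_neg, Prod.fst_add, Prod.snd_add]
    ring

namespace IsTransverseTriple

variable {ω₁ ω₂ ω₃ : ℂ × ℂ → ℂ × ℂ} {z : ℂ × ℂ}

theorem cycle (h : IsTransverseTriple ω₁ ω₂ ω₃ z) : IsTransverseTriple ω₂ ω₃ ω₁ z :=
  ⟨h.an₂, h.an₃, h.an₁, h.ne₂₃, h.ne₃₁, h.ne₁₂⟩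

theorem swap (h : IsTransverseTriple ω₁ ω₂ ω₃ z) : IsTransverseTriple ω₂ ω₁ ω₃ z :=
  ⟨h.an₂, h.an₁, h.an₃, wedge_ne_zero_symm h.ne₁₂, wedge_ne_zero_symm h.ne₃₁,
    wedge_ne_zero_symm h.ne₂₃⟩

theorem eventually (h : IsTransverseTriple ω₁ ω₂ ω₃ z) :
    ∀ᶠ w in 𝓝 z, IsTransverseTriple ω₁ ω₂ ω₃ w := by
  filter_upwards [h.an₁.eventually_analyticAt, h.an₂.eventually_analyticAt,
    h.an₃.eventually_analyticAt, (h.an₁.wedge h.an₂).continuousAt.eventually_ne h.ne₁₂,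
    (h.an₂.wedge h.an₃).continuousAt.eventually_ne h.ne₂₃,
    (h.an₃.wedge h.an₁).continuousAt.eventually_ne h.ne₃₁] with w a b c d e f
  exact ⟨a, b, c, d, e, f⟩

theorem analyticAt_normForm (h : IsTransverseTriple ω₁ ω₂ ω₃ z) :
    AnalyticAt ℂ (normForm ω₁ ω₂ ω₃) z :=
  (h.an₂.wedge h.an₃).smul h.an₁

theorem wedge_normForm_ne_zero (h : IsTransverseTriple ω₁ ω₂ ω₃ z) :
    wedge (normForm ω₁ ω₂ ω₃ z) (normForm ω₂ ω₃ ω₁ z) ≠ 0 := by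
  rw [wedge_normForm]
  exact mul_ne_zero (mul_ne_zero h.ne₁₂ h.ne₂₃) h.ne₃₁

theorem analyticAt_fundForm (h : IsTransverseTriple ω₁ ω₂ ω₃ z) :
    AnalyticAt ℂ (fundForm ω₁ ω₂ ω₃) z := by
  have h1 := h.analyticAt_normForm
  have h2 := h.cycle.analyticAt_normForm
  exact ((h1.wedge h2).inv h.wedge_normForm_ne_zero).smul
    ((h2.extDer.smul h1).sub (h1.extDer.smul h2))

/-- `fundForm` is the solution given by Cramer's rule to the first two defining equations. -/
theorem extDer_normForm_fst (h : IsTransverseTriple ω₁ ω₂ ω₃ z) :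
    extDer (normForm ω₁ ω₂ ω₃) z = wedge (fundForm ω₁ ω₂ ω₃ z) (normForm ω₁ ω₂ ω₃ z) := by
  have h0 := h.wedge_normForm_ne_zero
  have e : wedge (fundForm ω₁ ω₂ ω₃ z) (normForm ω₁ ω₂ ω₃ z) =
      (wedge (normForm ω₁ ω₂ ω₃ z) (normForm ω₂ ω₃ ω₁ z))⁻¹ *
        (extDer (normForm ω₁ ω₂ ω₃) z *
          wedge (normForm ω₁ ω₂ ω₃ z) (normForm ω₂ ω₃ ω₁ z)) := by
    rw [fundForm]
    generalize (wedge (normForm ω₁ ω₂ ω₃ z) (normForm ω₂ ω₃ ω₁ z))⁻¹ = c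
    simp only [wedge, Prod.smul_fst, Prod.smul_snd, smul_eq_mul, Prod.fst_sub, Prod.snd_sub]
    ring
  rw [e]
  field_simp

theorem extDer_normForm_snd (h : IsTransverseTriple ω₁ ω₂ ω₃ z) :
    extDer (normForm ω₂ ω₃ ω₁) z = wedge (fundForm ω₁ ω₂ ω₃ z) (normForm ω₂ ω₃ ω₁ z) := by
  have h0 := h.wedge_normForm_ne_zero
  have e : wedge (fundForm ω₁ ω₂ ω₃ z) (normForm ω₂ ω₃ ω₁ z) =
      (wedge (normForm ω₁ ω₂ ω₃ z) (normForm ω₂ ω₃ ω₁ z))⁻¹ *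
        (extDer (normForm ω₂ ω₃ ω₁) z *
          wedge (normForm ω₁ ω₂ ω₃ z) (normForm ω₂ ω₃ ω₁ z)) := by
    rw [fundForm]
    generalize (wedge (normForm ω₁ ω₂ ω₃ z) (normForm ω₂ ω₃ ω₁ z))⁻¹ = c
    simp only [wedge, Prod.smul_fst, Prod.smul_snd, smul_eq_mul, Prod.fst_sub, Prod.snd_sub]
    ring
  rw [e]
  field_simp

theorem extDer_normForm_third (h : IsTransverseTriple ω₁ ω₂ ω₃ z) :
    extDer (normForm ω₃ ω₁ ω₂) z = wedge (fundForm ω₁ ω₂ ω₃ z) (normForm ω₃ ω₁ ω₂ z) := by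
  rw [normForm_third, extDer_neg, extDer_add h.analyticAt_normForm.differentiableAt
    h.cycle.analyticAt_normForm.differentiableAt, h.extDer_normForm_fst, h.extDer_normForm_snd]
  simp only [wedge, Prod.fst_neg, Prod.snd_neg, Prod.fst_add, Prod.snd_add]
  ring

/-- The exterior derivative of the fundamental form only depends on the two normalized forms up
to a common nonvanishing factor. -/
theorem extDer_fundForm_eq_of_rescale (h : IsTransverseTriple ω₁ ω₂ ω₃ z) {η' : ℂ × ℂ → ℂ × ℂ}
    {f : ℂ × ℂ → ℂ} (hf : AnalyticAt ℂ f z) (hf0 : f z ≠ 0)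
    (h₁ : ∀ᶠ w in 𝓝 z, extDer (fun w => f w • normForm ω₁ ω₂ ω₃ w) w =
      wedge (η' w) (f w • normForm ω₁ ω₂ ω₃ w))
    (h₂ : ∀ᶠ w in 𝓝 z, extDer (fun w => f w • normForm ω₂ ω₃ ω₁ w) w =
      wedge (η' w) (f w • normForm ω₂ ω₃ ω₁ w)) :
    extDer η' z = extDer (fundForm ω₁ ω₂ ω₃) z :=
  extDer_eq_of_rescale h.analyticAt_fundForm hf hf0 h.analyticAt_normForm
    h.cycle.analyticAt_normForm h.wedge_normForm_ne_zero
    (h.eventually.mono fun _ hw => hw.extDer_normForm_fst)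
    (h.eventually.mono fun _ hw => hw.extDer_normForm_snd) h₁ h₂

/-- Uniqueness: the two normalized forms are a basis of covectors. The invariance of `fundForm`
under permutations follows from it. -/
theorem fundForm_eq_of_wedge_eq (h : IsTransverseTriple ω₁ ω₂ ω₃ z) {η : ℂ × ℂ}
    (h₁ : extDer (normForm ω₁ ω₂ ω₃) z = wedge η (normForm ω₁ ω₂ ω₃ z))
    (h₂ : extDer (normForm ω₂ ω₃ ω₁) z = wedge η (normForm ω₂ ω₃ ω₁ z)) :
    η = fundForm ω₁ ω₂ ω₃ z :=
  eq_of_wedge_eq h.wedge_normForm_ne_zero (h₁.symm.trans h.extDer_normForm_fst)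
    (h₂.symm.trans h.extDer_normForm_snd)

theorem fundForm_cycle (h : IsTransverseTriple ω₁ ω₂ ω₃ z) :
    fundForm ω₂ ω₃ ω₁ z = fundForm ω₁ ω₂ ω₃ z :=
  (h.cycle.fundForm_eq_of_wedge_eq h.extDer_normForm_snd h.extDer_normForm_third).symm

theorem fundForm_swap (h : IsTransverseTriple ω₁ ω₂ ω₃ z) :
    fundForm ω₂ ω₁ ω₃ z = fundForm ω₁ ω₂ ω₃ z := by
  refine (h.swap.fundForm_eq_of_wedge_eq ?_ ?_).symm
  · rw [normForm_swap ω₂ ω₃ ω₁, extDer_neg, h.extDer_normForm_snd]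
    simp only [wedge, Prod.fst_neg, Prod.snd_neg]; ring
  · rw [normForm_swap ω₁ ω₂ ω₃, extDer_neg, h.extDer_normForm_fst]
    simp only [wedge, Prod.fst_neg, Prod.snd_neg]; ring

theorem extDer_fundForm_cycle (h : IsTransverseTriple ω₁ ω₂ ω₃ z) :
    extDer (fundForm ω₂ ω₃ ω₁) z = extDer (fundForm ω₁ ω₂ ω₃) z :=
  extDer_congr (h.eventually.mono fun _ hw => hw.fundForm_cycle)

theorem extDer_fundForm_swap (h : IsTransverseTriple ω₁ ω₂ ω₃ z) :
    extDer (fundForm ω₂ ω₁ ω₃) z = extDer (fundForm ω₁ ω₂ ω₃) z :=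
  extDer_congr (h.eventually.mono fun _ hw => hw.fundForm_swap)

/-- The exterior derivative of the fundamental form does not depend on the choice of the forms
defining the three foliations. -/
theorem extDer_fundForm_congr (h : IsTransverseTriple ω₁ ω₂ ω₃ z)
    {ω₁' ω₂' ω₃' : ℂ × ℂ → ℂ × ℂ} (h' : IsTransverseTriple ω₁' ω₂' ω₃' z)
    {f₁ f₂ f₃ : ℂ × ℂ → ℂ} (a₁ : AnalyticAt ℂ f₁ z) (a₂ : AnalyticAt ℂ f₂ z)
    (a₃ : AnalyticAt ℂ f₃ z) (n₁ : f₁ z ≠ 0) (n₂ : f₂ z ≠ 0) (n₃ : f₃ z ≠ 0)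
    (e₁ : ∀ᶠ w in 𝓝 z, ω₁' w = f₁ w • ω₁ w) (e₂ : ∀ᶠ w in 𝓝 z, ω₂' w = f₂ w • ω₂ w)
    (e₃ : ∀ᶠ w in 𝓝 z, ω₃' w = f₃ w • ω₃ w) :
    extDer (fundForm ω₁' ω₂' ω₃') z = extDer (fundForm ω₁ ω₂ ω₃) z := by
  -- Each normalized form is linear in each of the three forms, so all of them acquire the same
  -- factor f₁ f₂ f₃.
  have k₁ : ∀ᶠ w in 𝓝 z, normForm ω₁' ω₂' ω₃' w =
      (f₁ w * f₂ w * f₃ w) • normForm ω₁ ω₂ ω₃ w := by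
    filter_upwards [e₁, e₂, e₃] with w h1 h2 h3
    ext <;>
    · simp only [normForm, wedge, h1, h2, h3, Prod.smul_fst, Prod.smul_snd, smul_eq_mul]
      ring
  have k₂ : ∀ᶠ w in 𝓝 z, normForm ω₂' ω₃' ω₁' w =
      (f₁ w * f₂ w * f₃ w) • normForm ω₂ ω₃ ω₁ w := by
    filter_upwards [e₁, e₂, e₃] with w h1 h2 h3
    ext <;>
    · simp only [normForm, wedge, h1, h2, h3, Prod.smul_fst, Prod.smul_snd, smul_eq_mul]
      ring
  refine h.extDer_fundForm_eq_of_rescale (f := fun w => f₁ w * f₂ w * f₃ w)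
    ((a₁.mul a₂).mul a₃) (mul_ne_zero (mul_ne_zero n₁ n₂) n₃) ?_ ?_
  · filter_upwards [k₁.eventually_nhds, h'.eventually] with w hw hw'
    rw [← extDer_congr hw, ← hw.self_of_nhds, hw'.extDer_normForm_fst]
  · filter_upwards [k₂.eventually_nhds, h'.eventually] with w hw hw'
    rw [← extDer_congr hw, ← hw.self_of_nhds, hw'.extDer_normForm_snd]

end IsTransverseTriple

theorem IsFundamentalForm.eq_fundForm {U : Set (ℂ × ℂ)} {ω₁ ω₂ ω₃ η : ℂ × ℂ → ℂ × ℂ}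
    (hη : IsFundamentalForm U ω₁ ω₂ ω₃ η) {z : ℂ × ℂ} (hz : z ∈ U)
    (h : IsTransverseTriple ω₁ ω₂ ω₃ z) : η z = fundForm ω₁ ω₂ ω₃ z :=
  h.fundForm_eq_of_wedge_eq (hη.eq₁ z hz) (hη.eq₂ z hz)

theorem isFundamentalForm_fundForm {U : Set (ℂ × ℂ)} {ω₁ ω₂ ω₃ : ℂ × ℂ → ℂ × ℂ}
    (h : ∀ z ∈ U, IsTransverseTriple ω₁ ω₂ ω₃ z) :
    IsFundamentalForm U ω₁ ω₂ ω₃ (fundForm ω₁ ω₂ ω₃) :=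
  ⟨fun z hz => (h z hz).analyticAt_fundForm, fun z hz => (h z hz).extDer_normForm_fst,
    fun z hz => (h z hz).extDer_normForm_snd, fun z hz => (h z hz).extDer_normForm_third⟩

/-- A `3`-web defined by `θ - ξ₁ α`, `θ - ξ₂ α` and `α`, where `θ` and `α` are closed and
`dξ₁ ∧ α = dξ₂ ∧ α = 0`, is flat. -/
theorem extDer_fundForm_eq_zero {ω₁ ω₂ ω₃ θ α : ℂ × ℂ → ℂ × ℂ} {u₁ u₂ u₃ ξ₁ ξ₂ : ℂ × ℂ → ℂ}
    {z : ℂ × ℂ} (h : IsTransverseTriple ω₁ ω₂ ω₃ z)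
    (hθ : AnalyticAt ℂ θ z) (hα : AnalyticAt ℂ α z)
    (hu₁ : AnalyticAt ℂ u₁ z) (hu₂ : AnalyticAt ℂ u₂ z) (hu₃ : AnalyticAt ℂ u₃ z)
    (hξ₁ : AnalyticAt ℂ ξ₁ z) (hξ₂ : AnalyticAt ℂ ξ₂ z)
    (n₁ : u₁ z ≠ 0) (n₂ : u₂ z ≠ 0) (n₃ : u₃ z ≠ 0) (hn : wedge (θ z) (α z) ≠ 0)
    (e₁ : ∀ᶠ w in 𝓝 z, ω₁ w = u₁ w • (θ w + (-ξ₁ w) • α w))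
    (e₂ : ∀ᶠ w in 𝓝 z, ω₂ w = u₂ w • (θ w + (-ξ₂ w) • α w))
    (e₃ : ∀ᶠ w in 𝓝 z, ω₃ w = u₃ w • α w)
    (dθ : ∀ᶠ w in 𝓝 z, extDer θ w = 0) (dα : ∀ᶠ w in 𝓝 z, extDer α w = 0)
    (dξ₁ : ∀ᶠ w in 𝓝 z, wedge (dForm ξ₁ w) (α w) = 0)
    (dξ₂ : ∀ᶠ w in 𝓝 z, wedge (dForm ξ₂ w) (α w) = 0) :
    extDer (fundForm ω₁ ω₂ ω₃) z = 0 := by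
  -- Since (θ - ξ α) ∧ α = θ ∧ α, this is the factor common to the first two normalized forms.
  set g : ℂ × ℂ → ℂ := fun w => u₁ w * u₂ w * u₃ w * wedge (θ w) (α w) with hg
  have ag : AnalyticAt ℂ g z := ((hu₁.mul hu₂).mul hu₃).mul (hθ.wedge hα)
  have g0 : g z ≠ 0 := mul_ne_zero (mul_ne_zero (mul_ne_zero n₁ n₂) n₃) hn
  have closed : ∀ ξ : ℂ × ℂ → ℂ, AnalyticAt ℂ ξ z →
      (∀ᶠ w in 𝓝 z, wedge (dForm ξ w) (α w) = 0) →
      ∀ᶠ w in 𝓝 z, extDer (fun w => θ w + (-ξ w) • α w) w = 0 := by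
    intro ξ hξ dξ
    filter_upwards [dξ, dθ, dα, hθ.eventually_analyticAt, hα.eventually_analyticAt,
      hξ.eventually_analyticAt] with w h1 h2 h3 h4 h5 h6
    have h7 : DifferentiableAt ℂ (fun w => -ξ w) w := h6.neg.differentiableAt
    rw [extDer_add h4.differentiableAt (h7.fun_smul h5.differentiableAt),
      extDer_smul h7 h5.differentiableAt, h2, h3]
    have : dForm (fun w => -ξ w) w = -dForm ξ w := by
      simp [dForm, fderiv_fun_neg]
    rw [this]
    simp only [wedge, Prod.fst_neg, Prod.snd_neg] at h1 ⊢
    linear_combination -h1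
  have k₁ : ∀ᶠ w in 𝓝 z, (g w)⁻¹ • normForm ω₁ ω₂ ω₃ w = θ w + (-ξ₁ w) • α w := by
    filter_upwards [e₁, e₂, e₃, ag.continuousAt.eventually_ne g0] with w h1 h2 h3 h4
    have : normForm ω₁ ω₂ ω₃ w = g w • (θ w + (-ξ₁ w) • α w) := by
      ext <;>
      · simp only [hg, normForm, wedge, h1, h2, h3, Prod.smul_fst, Prod.smul_snd, smul_eq_mul,
          Prod.fst_add, Prod.snd_add]
        ring
    rw [this, smul_smul, inv_mul_cancel₀ h4, one_smul]
  have k₂ : ∀ᶠ w in 𝓝 z, (g w)⁻¹ • normForm ω₂ ω₃ ω₁ w = -(θ w + (-ξ₂ w) • α w) := by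
    filter_upwards [e₁, e₂, e₃, ag.continuousAt.eventually_ne g0] with w h1 h2 h3 h4
    have : normForm ω₂ ω₃ ω₁ w = g w • (-(θ w + (-ξ₂ w) • α w)) := by
      ext <;>
      · simp only [hg, normForm, wedge, h1, h2, h3, Prod.smul_fst, Prod.smul_snd, smul_eq_mul,
          Prod.fst_add, Prod.snd_add, Prod.fst_neg, Prod.snd_neg]
        ring
    rw [this, smul_smul, inv_mul_cancel₀ h4, one_smul]
  -- After division by `g` the normalized forms are closed, so the zero form is a connection form
  -- for them.
  have := h.extDer_fundForm_eq_of_rescale (η' := fun _ => 0) (f := fun w => (g w)⁻¹)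
    (ag.inv g0) (inv_ne_zero g0) ?_ ?_
  · rw [← this, extDer_zero]
  · filter_upwards [k₁.eventually_nhds, closed ξ₁ hξ₁ dξ₁] with w hw hc
    rw [extDer_congr hw, hc]
    simp [wedge]
  · filter_upwards [k₂.eventually_nhds, closed ξ₂ hξ₂ dξ₂] with w hw hc
    rw [extDer_congr hw, extDer_neg, hc]
    simp [wedge]

/-! ### The curvature of a web computed from a decomposition -/

/-- A function of triples which is invariant under permutations: its sum over all triples of
distinct indices is six times its sum over increasing triples. -/
theorem sum_distinct_triples {d : ℕ} (F : Fin d → Fin d → Fin d → ℂ)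
    (hc : ∀ r s t, r ≠ s → s ≠ t → r ≠ t → F s t r = F r s t)
    (hs : ∀ r s t, r ≠ s → s ≠ t → r ≠ t → F s r t = F r s t) :
    (∑ r, ∑ s, ∑ t, if r ≠ s ∧ s ≠ t ∧ r ≠ t then F r s t else 0) =
      6 * ∑ r, ∑ s, ∑ t, if r < s ∧ s < t then F r s t else 0 := by
  set G : Fin d → Fin d → Fin d → ℂ := fun r s t => if r < s ∧ s < t then F r s t else 0 with hG
  -- Exactly one of the six orderings of a triple of distinct indices is increasing.
  have key : ∀ r s t, (if r ≠ s ∧ s ≠ t ∧ r ≠ t then F r s t else 0) =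
      G r s t + G s t r + G t r s + G s r t + G r t s + G t s r := by
    intro r s t
    by_cases h : r ≠ s ∧ s ≠ t ∧ r ≠ t
    · obtain ⟨h1, h2, h3⟩ := h
      have a1 := hc r s t h1 h2 h3
      have a2 := hc s t r h2 h3.symm h1.symm
      have a3 := hs r s t h1 h2 h3
      have a4 := hs s t r h2 h3.symm h1.symm
      have a5 := hs t r s h3.symm h1 h2.symm
      simp only [hG]
      rcases lt_or_gt_of_ne h1 with b1 | b1 <;> rcases lt_or_gt_of_ne h2 with b2 | b2 <;>
        rcases lt_or_gt_of_ne h3 with b3 | b3 <;>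
        first
          | (exfalso; omega)
          | simp [b1, b2, b3, b1.not_gt, b2.not_gt, b3.not_gt, h1, h2, h3, a1, a2, a3, a4, a5]
    · have : r = s ∨ s = t ∨ r = t := by tauto
      rw [if_neg h]
      simp only [hG]
      rcases this with rfl | rfl | rfl
      · have e : ¬ (r < t ∧ t < r) := fun h => lt_asymm h.1 h.2
        simp [e]
      · have e : ¬ (s < r ∧ r < s) := fun h => lt_asymm h.1 h.2
        simp [e]
      · have e : ¬ (r < s ∧ s < r) := fun h => lt_asymm h.1 h.2
        simp [e]
  have swap12 : ∀ A : Fin d → Fin d → Fin d → ℂ,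
      ∑ r, ∑ s, ∑ t, A s r t = ∑ r, ∑ s, ∑ t, A r s t := fun A => Finset.sum_comm
  have swap23 : ∀ A : Fin d → Fin d → Fin d → ℂ,
      ∑ r, ∑ s, ∑ t, A r t s = ∑ r, ∑ s, ∑ t, A r s t := fun A =>
    Finset.sum_congr rfl fun r _ => Finset.sum_comm
  simp only [key, Finset.sum_add_distrib]
  have p1 : ∑ r, ∑ s, ∑ t, G s t r = ∑ r, ∑ s, ∑ t, G r s t := by
    rw [swap12 fun s r t => G s t r, swap23]
  have p2 : ∑ r, ∑ s, ∑ t, G t r s = ∑ r, ∑ s, ∑ t, G r s t := by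
    rw [swap23 fun r t s => G t r s, swap12]
  have p3 : ∑ r, ∑ s, ∑ t, G t s r = ∑ r, ∑ s, ∑ t, G r s t := by
    rw [swap12 fun s r t => G t s r, p2]
  rw [p1, p2, p3, swap12 G, swap23 G]
  ring

/-- The curvature at `z` of the web defined by the forms `ω i`. -/
def curvatureOf {d : ℕ} (ω : Fin d → ℂ × ℂ → ℂ × ℂ) (z : ℂ × ℂ) : ℂ :=
  ∑ r, ∑ s, ∑ t, if r < s ∧ s < t then extDer (fundForm (ω r) (ω s) (ω t)) z else 0

theorem wedge_eq_zero_of_common {a b c : ℂ × ℂ} (hc : c ≠ 0) (ha : wedge a c = 0)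
    (hb : wedge b c = 0) : wedge a b = 0 := by
  simp only [wedge] at *
  by_cases h : c.1 = 0
  · have h2 : c.2 ≠ 0 := fun h2 => hc (Prod.ext h h2)
    have : c.2 * (a.1 * b.2 - a.2 * b.1) = 0 := by linear_combination b.2 * ha - a.2 * hb
    exact (mul_eq_zero.1 this).resolve_left h2
  · have : c.1 * (a.1 * b.2 - a.2 * b.1) = 0 := by linear_combination b.1 * ha - a.1 * hb
    exact (mul_eq_zero.1 this).resolve_left h

/-- Two analytic forms with the same kernel differ by a nonvanishing analytic factor. -/
theorem exists_factor_of_wedge_eq_zero {a b : ℂ × ℂ → ℂ × ℂ} {z : ℂ × ℂ} (ha : AnalyticAt ℂ a z)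
    (hb : AnalyticAt ℂ b z) (ha0 : a z ≠ 0) (hb0 : b z ≠ 0)
    (h : ∀ᶠ w in 𝓝 z, wedge (a w) (b w) = 0) :
    ∃ f : ℂ × ℂ → ℂ, AnalyticAt ℂ f z ∧ f z ≠ 0 ∧ ∀ᶠ w in 𝓝 z, b w = f w • a w := by
  have hz := h.self_of_nhds
  by_cases h1 : (a z).1 = 0
  · have h2 : (a z).2 ≠ 0 := fun h2 => ha0 (Prod.ext h1 h2)
    refine ⟨fun w => (b w).2 / (a w).2, hb.prodSnd.div ha.prodSnd h2, ?_, ?_⟩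
    · refine div_ne_zero (fun hb2 => hb0 (Prod.ext ?_ hb2)) h2
      simp only [wedge, h1, hb2] at hz
      simpa [h2] using hz
    · filter_upwards [h, ha.prodSnd.continuousAt.eventually_ne h2] with w hw h2w
      simp only [wedge] at hw
      ext
      · simp only [Prod.smul_fst, smul_eq_mul]
        field_simp
        linear_combination -hw
      · simp only [Prod.smul_snd, smul_eq_mul]
        field_simp
  · refine ⟨fun w => (b w).1 / (a w).1, hb.prodFst.div ha.prodFst h1, ?_, ?_⟩
    · refine div_ne_zero (fun hb1 => hb0 (Prod.ext hb1 ?_)) h1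
      simp only [wedge, hb1] at hz
      simpa [h1] using hz
    · filter_upwards [h, ha.prodFst.continuousAt.eventually_ne h1] with w hw h1w
      simp only [wedge] at hw
      ext
      · simp only [Prod.smul_fst, smul_eq_mul]
        field_simp
      · simp only [Prod.smul_snd, smul_eq_mul]
        field_simp
        linear_combination hw

/-- A vector spanning the kernel of a nonzero covector. -/
def kerVec (a : ℂ × ℂ) : ℂ × ℂ := (a.2, -a.1)

theorem kerVec_ne_zero {a : ℂ × ℂ} (ha : a ≠ 0) : kerVec a ≠ 0 := by
  intro h
  simp only [kerVec, Prod.mk_eq_zero, neg_eq_zero] at h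
  exact ha (Prod.ext h.2 h.1)

theorem pairing_kerVec (a b : ℂ × ℂ) :
    a.1 * (kerVec b).1 + a.2 * (kerVec b).2 = wedge a b := by
  simp only [kerVec, wedge]; ring

namespace IsDecomposition

variable {d : ℕ} {W : ℂ × ℂ → Set (ℂ × ℂ)} {U : Set (ℂ × ℂ)} {ω : Fin d → ℂ × ℂ → ℂ × ℂ}

theorem mono (h : IsDecomposition d W U ω) {V : Set (ℂ × ℂ)} (hV : IsOpen V) (hVU : V ⊆ U) :
    IsDecomposition d W V ω :=
  ⟨hV, fun i z hz => h.analytic i z (hVU hz), fun i z hz => h.ne_zero i z (hVU hz),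
    fun i j hij z hz => h.transverse i j hij z (hVU hz),
    fun z hz => h.directions z (hVU hz)⟩

/-- Expresses membership in the web by a wedge product, so that two decompositions of one web can be
compared form by form. -/
theorem kerVec_mem_iff (h : IsDecomposition d W U ω) {z : ℂ × ℂ} (hz : z ∈ U) {a : ℂ × ℂ}
    (ha : a ≠ 0) : kerVec a ∈ W z ↔ ∃ i, wedge (ω i z) a = 0 := by
  rw [h.directions z hz _ (kerVec_ne_zero ha)]
  simp only [pairing_kerVec]

theorem triple (h : IsDecomposition d W U ω) {z : ℂ × ℂ} (hz : z ∈ U) {r s t : Fin d}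
    (h1 : r ≠ s) (h2 : s ≠ t) (h3 : r ≠ t) : IsTransverseTriple (ω r) (ω s) (ω t) z :=
  ⟨h.analytic r z hz, h.analytic s z hz, h.analytic t z hz, h.transverse r s h1 z hz,
    h.transverse s t h2 z hz, h.transverse t r h3.symm z hz⟩

theorem sum_distinct (h : IsDecomposition d W U ω) {z : ℂ × ℂ} (hz : z ∈ U) :
    (∑ r, ∑ s, ∑ t, if r ≠ s ∧ s ≠ t ∧ r ≠ t then extDer (fundForm (ω r) (ω s) (ω t)) z else 0) =
      6 * curvatureOf ω z :=
  sum_distinct_triples _ (fun _ _ _ h1 h2 h3 => (h.triple hz h1 h2 h3).extDer_fundForm_cycle)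
    (fun _ _ _ h1 h2 h3 => (h.triple hz h1 h2 h3).extDer_fundForm_swap)

/-- The curvature does not depend on the decomposition. -/
theorem curvatureOf_eq (h : IsDecomposition d W U ω) {U' : Set (ℂ × ℂ)}
    {ω' : Fin d → ℂ × ℂ → ℂ × ℂ} (h' : IsDecomposition d W U' ω') {z : ℂ × ℂ} (hz : z ∈ U)
    (hz' : z ∈ U') : curvatureOf ω' z = curvatureOf ω z := by
  have hex : ∀ w ∈ U, w ∈ U' → ∀ i, ∃ j, wedge (ω j w) (ω' i w) = 0 := by
    intro w hw hw' i
    rw [← h.kerVec_mem_iff hw (h'.ne_zero i w hw'), h'.kerVec_mem_iff hw' (h'.ne_zero i w hw')]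
    exact ⟨i, by simp only [wedge]; ring⟩
  -- `σ` matches the foliations of the two decompositions at `z`; it is injective because those of
  -- `ω'` are transverse.
  choose σ hσ using hex z hz hz'
  have σinj : Function.Injective σ := by
    intro i j hij
    by_contra hne
    refine h'.transverse i j hne z hz' (wedge_eq_zero_of_common (h.ne_zero (σ i) z hz) ?_ ?_)
    · rw [wedge_comm, hσ, neg_zero]
    · rw [hij, wedge_comm, hσ, neg_zero]
  -- The matching persists near `z`: at a nearby point `ω' i` is proportional to some `ω j`, and by
  -- continuity every `j ≠ σ i` is excluded.
  have hloc : ∀ i, ∀ᶠ w in 𝓝 z, wedge (ω (σ i) w) (ω' i w) = 0 := by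
    intro i
    have hne : ∀ᶠ w in 𝓝 z, ∀ j, j ≠ σ i → wedge (ω j w) (ω' i w) ≠ 0 := by
      rw [eventually_all]
      intro j
      by_cases hj : j = σ i
      · exact Eventually.of_forall fun w hw => absurd hj hw
      · refine (((h.analytic j z hz).wedge (h'.analytic i z hz')).continuousAt.eventually_ne
          ?_).mono fun w hw _ => hw
        intro h0
        refine h.transverse j (σ i) hj z hz (wedge_eq_zero_of_common (h'.ne_zero i z hz') h0 (hσ i))
    filter_upwards [hne, h.isOpen.mem_nhds hz, h'.isOpen.mem_nhds hz'] with w hw hwU hwU'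
    obtain ⟨j, hj⟩ := hex w hwU hwU' i
    by_cases hji : j = σ i
    · rwa [hji] at hj
    · exact absurd hj (hw j hji)
  choose f fan fne hf using fun i => exists_factor_of_wedge_eq_zero (h.analytic (σ i) z hz)
    (h'.analytic i z hz') (h.ne_zero (σ i) z hz) (h'.ne_zero i z hz') (hloc i)
  have hbij : Function.Bijective σ := Finite.injective_iff_bijective.1 σinj
  -- `σ` need not be increasing, so the reindexing is done on sums over all triples of distinct
  -- indices.
  have hs : 6 * curvatureOf ω' z = 6 * curvatureOf ω z := by
    rw [← h.sum_distinct hz, ← h'.sum_distinct hz']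
    symm
    rw [← hbij.sum_comp]
    refine Finset.sum_congr rfl fun r _ => ?_
    rw [← hbij.sum_comp]
    refine Finset.sum_congr rfl fun s _ => ?_
    rw [← hbij.sum_comp]
    refine Finset.sum_congr rfl fun t _ => ?_
    simp only [ne_eq, σinj.eq_iff]
    refine if_ctx_congr Iff.rfl (fun hd => ?_) fun _ => rfl
    obtain ⟨h1, h2, h3⟩ := hd
    exact ((h.triple hz (σinj.ne h1) (σinj.ne h2) (σinj.ne h3)).extDer_fundForm_congr
      (h'.triple hz' h1 h2 h3) (fan r) (fan s) (fan t) (fne r) (fne s) (fne t)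
      (hf r) (hf s) (hf t)).symm
  exact mul_left_cancel₀ (by norm_num) hs

/-- The value selected by `Classical.epsilon` comes from some decomposition near `z`, whose
fundamental forms must be the `fundForm`s by uniqueness; independence of the decomposition does the
rest. -/
theorem webCurvature_eq (h : IsDecomposition d W U ω) {z : ℂ × ℂ} (hz : z ∈ U) :
    webCurvature d W z = curvatureOf ω z := by
  have tri : ∀ {U : Set (ℂ × ℂ)} {ω : Fin d → ℂ × ℂ → ℂ × ℂ}
      (η : Fin d → Fin d → Fin d → ℂ × ℂ → ℂ × ℂ), IsDecomposition d W U ω → z ∈ U →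
      (∀ r s t, r < s → s < t → IsFundamentalForm U (ω r) (ω s) (ω t) (η r s t)) →
      extDer (tripleSum η) z = curvatureOf ω z := by
    intro U ω η hd hz hη
    have hdiff : ∀ r s t, DifferentiableAt ℂ (fun w => if r < s ∧ s < t then η r s t w else 0) z := by
      intro r s t
      by_cases hrst : r < s ∧ s < t
      · simp only [hrst, and_self, if_true]
        exact ((hη r s t hrst.1 hrst.2).analytic z hz).differentiableAt
      · simp only [hrst, if_false]
        exact differentiableAt_const _
    have hdiff2 : ∀ r s, DifferentiableAt ℂ
        (fun w => ∑ t, if r < s ∧ s < t then η r s t w else 0) z := fun r s =>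
      DifferentiableAt.fun_sum fun t _ => hdiff r s t
    have hdiff3 : ∀ r, DifferentiableAt ℂ
        (fun w => ∑ s, ∑ t, if r < s ∧ s < t then η r s t w else 0) z := fun r =>
      DifferentiableAt.fun_sum fun s _ => hdiff2 r s
    unfold tripleSum curvatureOf
    rw [extDer_sum _ _ fun r _ => hdiff3 r]
    refine Finset.sum_congr rfl fun r _ => ?_
    rw [extDer_sum _ _ fun s _ => hdiff2 r s]
    refine Finset.sum_congr rfl fun s _ => ?_
    rw [extDer_sum _ _ fun t _ => hdiff r s t]
    refine Finset.sum_congr rfl fun t _ => ?_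
    by_cases hrst : r < s ∧ s < t
    · simp only [hrst, and_self, if_true]
      refine extDer_congr ?_
      filter_upwards [hd.isOpen.mem_nhds hz] with w hw
      exact (hη r s t hrst.1 hrst.2).eq_fundForm hw
        (hd.triple hw hrst.1.ne hrst.2.ne (hrst.1.trans hrst.2).ne)
    · simp only [hrst, if_false, extDer_zero]
  have hex : HasCurvatureAt d W z (curvatureOf ω z) := by
    refine ⟨U, ω, fun r s t => fundForm (ω r) (ω s) (ω t), hz, h, ?_, ?_⟩
    · intro r s t h1 h2
      exact isFundamentalForm_fundForm fun w hw => h.triple hw h1.ne h2.ne (h1.trans h2).ne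
    · refine (tri _ h hz ?_).symm
      intro r s t h1 h2
      exact isFundamentalForm_fundForm fun w hw => h.triple hw h1.ne h2.ne (h1.trans h2).ne
  obtain ⟨U', ω', η', hz', h', hη', hκ⟩ := Classical.epsilon_spec (p := HasCurvatureAt d W z) ⟨_, hex⟩
  rw [webCurvature, hκ, tri η' h' hz' hη', h.curvatureOf_eq h' hz hz']

theorem continuousOn_curvatureOf (h : IsDecomposition d W U ω) :
    ContinuousOn (curvatureOf ω) U := by
  unfold curvatureOf
  refine continuousOn_finsetSum _ fun r _ => continuousOn_finsetSum _ fun s _ =>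
    continuousOn_finsetSum _ fun t _ => ?_
  by_cases hrst : r < s ∧ s < t
  · simp only [hrst, and_self, if_true]
    exact fun z hz => (h.triple hz hrst.1.ne hrst.2.ne
      (hrst.1.trans hrst.2).ne).analyticAt_fundForm.extDer.continuousAt.continuousWithinAt
  · simp only [hrst, if_false]
    exact continuousOn_const

end IsDecomposition

/-- If all the `3`-subwebs containing the `k`-th foliation are flat, this foliation does not
contribute to the curvature. -/
theorem curvatureOf_succAbove {n : ℕ} (ω : Fin (n + 1) → ℂ × ℂ → ℂ × ℂ) (k : Fin (n + 1))
    {z : ℂ × ℂ}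
    (h : ∀ r s t, r < s → s < t → r = k ∨ s = k ∨ t = k →
      extDer (fundForm (ω r) (ω s) (ω t)) z = 0) :
    curvatureOf ω z = curvatureOf (fun i => ω (k.succAbove i)) z := by
  have h' : ∀ r s t, r = k ∨ s = k ∨ t = k →
      (if r < s ∧ s < t then extDer (fundForm (ω r) (ω s) (ω t)) z else 0) = 0 := by
    intro r s t hk
    split_ifs with hrst
    · exact h r s t hrst.1 hrst.2 hk
    · rfl
  unfold curvatureOf
  rw [Fin.sum_univ_succAbove _ k]
  simp only [h' k _ _ (Or.inl rfl), Finset.sum_const_zero, zero_add]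
  refine Finset.sum_congr rfl fun r _ => ?_
  rw [Fin.sum_univ_succAbove _ k]
  simp only [h' _ k _ (Or.inr (Or.inl rfl)), Finset.sum_const_zero, zero_add]
  refine Finset.sum_congr rfl fun s _ => ?_
  rw [Fin.sum_univ_succAbove _ k]
  rw [h' _ _ k (Or.inr (Or.inr rfl)), zero_add]
  simp only [Fin.succAbove_lt_succAbove_iff]

/-! ### Tangency of a foliation with a line -/

/-- The cofactor identity. Points transform by `A` and lines by its transpose, so this computes the
image of the intersection of two pulled-back lines. -/
theorem mulVec_cross (A : Matrix (Fin 3) (Fin 3) ℂ) (a b : Fin 3 → ℂ) :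
    A *ᵥ ((Aᵀ *ᵥ a) ⨯₃ (Aᵀ *ᵥ b)) = A.det • (a ⨯₃ b) := by
  funext i
  fin_cases i <;>
  · simp [cross_apply, Matrix.mulVec, dotProduct, Fin.sum_univ_three, Matrix.det_fin_three]
    ring

theorem cross_mulVec_eq_zero_iff {A : Matrix (Fin 3) (Fin 3) ℂ} (hA : A.det ≠ 0)
    (a b : Fin 3 → ℂ) : (Aᵀ *ᵥ a) ⨯₃ (Aᵀ *ᵥ b) = 0 ↔ a ⨯₃ b = 0 := by
  have key := mulVec_cross A a b
  constructor
  · intro h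
    rw [h, Matrix.mulVec_zero] at key
    exact (smul_eq_zero.1 key.symm).resolve_left hA
  · intro h
    rw [h, smul_zero] at key
    exact Matrix.eq_zero_of_mulVec_eq_zero hA key

theorem eval_linearForm (a x : Fin 3 → ℂ) : MvPolynomial.eval x (linearForm a) = a ⬝ᵥ x := by
  simp [linearForm, dotProduct]

theorem eval_bind₁_linearForm (A : Matrix (Fin 3) (Fin 3) ℂ) (p : MvPolynomial (Fin 3) ℂ)
    (x : Fin 3 → ℂ) :
    MvPolynomial.eval x (MvPolynomial.bind₁ (fun k => linearForm (A k)) p) =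
      MvPolynomial.eval (A *ᵥ x) p := by
  have h : (MvPolynomial.eval x).comp
      (MvPolynomial.bind₁ fun k => linearForm (A k)).toRingHom = MvPolynomial.eval (A *ᵥ x) := by
    refine MvPolynomial.ringHom_ext (fun c => by simp) fun i => ?_
    simp [eval_linearForm, Matrix.mulVec]
  exact RingHom.congr_fun h p

namespace PlaneFoliation

variable {n : ℕ} (F : PlaneFoliation n)

/-- The value of the `1`-form defining the foliation. -/
def valueAt (x : Fin 3 → ℂ) : Fin 3 → ℂ := fun i => MvPolynomial.eval x (F.coeff i)

/-- The foliation is tangent to the line with equation `u` at its intersection point with the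
line with equation `u'`. -/
def Tangent (u u' : Fin 3 → ℂ) : Prop := F.valueAt (u ⨯₃ u') ⨯₃ u = 0

theorem valueAt_smul (c : ℂ) (x : Fin 3 → ℂ) :
    F.valueAt (c • x) = c ^ (n + 1) • F.valueAt x := by
  funext i
  simp only [valueAt, Pi.smul_apply, smul_eq_mul]
  rw [MvPolynomial.eval_eq', MvPolynomial.eval_eq', Finset.mul_sum]
  refine Finset.sum_congr rfl fun m hm => ?_
  have hdeg : ∑ j, m j = n + 1 := by
    have := F.homogeneous i (MvPolynomial.mem_support_iff.1 hm)
    simpa [Finsupp.weight_apply, Finsupp.sum_fintype] using this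
  simp only [Pi.smul_apply, smul_eq_mul, mul_pow, Finset.prod_mul_distrib]
  rw [Finset.prod_pow_eq_pow_sum, hdeg]
  ring

theorem valueAt_dotProduct (x : Fin 3 → ℂ) : F.valueAt x ⬝ᵥ x = 0 := by
  have := congrArg (MvPolynomial.eval x) F.euler
  simpa [valueAt, dotProduct, mul_comm] using this

variable {F}

theorem tangent_smul_left {c : ℂ} (hc : c ≠ 0) (u u' : Fin 3 → ℂ) :
    F.Tangent (c • u) u' ↔ F.Tangent u u' := by
  unfold Tangent
  simp [valueAt_smul, hc]

theorem tangent_smul_right {c : ℂ} (hc : c ≠ 0) (u u' : Fin 3 → ℂ) :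
    F.Tangent u (c • u') ↔ F.Tangent u u' := by
  unfold Tangent
  simp [valueAt_smul, hc]

/-- Together with the two scaling lemmas: tangency depends only on the line `u` and its intersection
with `u'`, so `u'` matters only modulo `u` and up to a factor. -/
theorem tangent_add_smul_right (c : ℂ) (u u' : Fin 3 → ℂ) :
    F.Tangent u (u' + c • u) ↔ F.Tangent u u' := by
  unfold Tangent
  simp

theorem IsHomogeneousIn.exists_valueAt {g : GL (Fin 3) ℂ} (hF : F.IsHomogeneousIn g) {c : ℂ}
    (hc : c ≠ 0) : ∃ a : ℂ, a ≠ 0 ∧ ∀ x,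
      (chartHomothety g c)ᵀ *ᵥ F.valueAt (chartHomothety g c *ᵥ x) = a • F.valueAt x := by
  obtain ⟨a, ha, h⟩ := hF c hc
  refine ⟨a, ha, fun x => ?_⟩
  funext j
  have hj := congrArg (MvPolynomial.eval x) (congrFun h j)
  have he : ∀ i, MvPolynomial.eval x (MvPolynomial.bind₁
      (fun k => linearForm (chartHomothety g c k)) (F.coeff i)) =
      F.valueAt (chartHomothety g c *ᵥ x) i := by
    intro i
    rw [valueAt, eval_bind₁_linearForm]
  simp only [pullbackForm, map_sum, map_mul, MvPolynomial.eval_C, he] at hj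
  exact hj

theorem det_ne_zero (g : GL (Fin 3) ℂ) : g.1.det ≠ 0 :=
  ((Matrix.isUnit_iff_isUnit_det _).1 g.isUnit).ne_zero

theorem det_chartHomothety_ne_zero (g : GL (Fin 3) ℂ) {c : ℂ} (hc : c ≠ 0) :
    (chartHomothety g c).det ≠ 0 := by
  unfold chartHomothety
  rw [Matrix.det_mul, Matrix.det_mul, Matrix.det_diagonal]
  refine mul_ne_zero (mul_ne_zero (det_ne_zero _) ?_) (det_ne_zero _)
  simp [Fin.prod_univ_three, hc]

/-- With φ the homothety, φ*Ω = aΩ. So Ω is proportional to the pulled-back line at the pulled-back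
point exactly when Ω is proportional to the original line at the original point. -/
theorem IsHomogeneousIn.tangent_transpose_iff {g : GL (Fin 3) ℂ} (hF : F.IsHomogeneousIn g) {c : ℂ}
    (hc : c ≠ 0) (y y' : Fin 3 → ℂ) :
    F.Tangent ((chartHomothety g c)ᵀ *ᵥ y) ((chartHomothety g c)ᵀ *ᵥ y') ↔ F.Tangent y y' := by
  obtain ⟨a, ha, h⟩ := hF.exists_valueAt hc
  have hdet := det_chartHomothety_ne_zero g hc
  set φ := chartHomothety g c
  have h1 := h ((φᵀ *ᵥ y) ⨯₃ (φᵀ *ᵥ y'))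
  rw [mulVec_cross, valueAt_smul, Matrix.mulVec_smul] at h1
  unfold Tangent
  rw [← smul_eq_zero_iff_right ha, ← LinearMap.map_smul₂, ← h1, LinearMap.map_smul₂,
    smul_eq_zero_iff_right (pow_ne_zero _ hdet), cross_mulVec_eq_zero_iff hdet]

/-- Tangency in the homogeneous coordinates of the chart `g`. -/
theorem IsHomogeneousIn.tangent_diagonal_iff {g : GL (Fin 3) ℂ} (hF : F.IsHomogeneousIn g) {c : ℂ}
    (hc : c ≠ 0) (w w' : Fin 3 → ℂ) :
    F.Tangent (g.1ᵀ *ᵥ ![c * w 0, c * w 1, w 2]) (g.1ᵀ *ᵥ ![c * w' 0, c * w' 1, w' 2]) ↔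
      F.Tangent (g.1ᵀ *ᵥ w) (g.1ᵀ *ᵥ w') := by
  have key : ∀ w : Fin 3 → ℂ, g.1ᵀ *ᵥ ![c * w 0, c * w 1, w 2] =
      (chartHomothety g c)ᵀ *ᵥ (g.1ᵀ *ᵥ w) := by
    intro w
    have h1 : g.1 * (g⁻¹ : GL (Fin 3) ℂ).1 = 1 := by
      rw [← Units.val_mul, mul_inv_cancel, Units.val_one]
    have h2 : (chartHomothety g c)ᵀ * g.1ᵀ = g.1ᵀ * Matrix.diagonal ![c, c, 1] := by
      rw [← Matrix.transpose_mul, chartHomothety, ← mul_assoc, ← mul_assoc, h1, one_mul,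
        Matrix.transpose_mul, Matrix.diagonal_transpose]
    rw [Matrix.mulVec_mulVec, h2, ← Matrix.mulVec_mulVec]
    congr 1
    funext i
    fin_cases i <;> simp [Matrix.mulVec_diagonal]
  rw [key, key, hF.tangent_transpose_iff hc]

/-- For a homogeneous foliation, tangency only depends on the slope of the line and on the
normalized abscissa of the point. -/
theorem IsHomogeneousIn.tangent_iff_normalized {g : GL (Fin 3) ℂ} (hF : F.IsHomogeneousIn g)
    {w w' : Fin 3 → ℂ} (h1 : w 1 ≠ 0) (h2 : w 2 ≠ 0) (hm : w 1 * w' 0 - w 0 * w' 1 ≠ 0) :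
    F.Tangent (g.1ᵀ *ᵥ w) (g.1ᵀ *ᵥ w') ↔
      F.Tangent (g.1ᵀ *ᵥ ![w 0 / w 1, 1, 1])
        (g.1ᵀ *ᵥ ![1, 0, w 1 * (w 1 * w' 2 - w 2 * w' 1) /
          (w 2 * (w 1 * w' 0 - w 0 * w' 1))]) := by
  -- The homothety of ratio w₂/w₁ brings the intercept of the line to 1.
  rw [← hF.tangent_diagonal_iff (div_ne_zero h2 h1) w w']
  set ξ := w 1 * (w 1 * w' 2 - w 2 * w' 1) / (w 2 * (w 1 * w' 0 - w 0 * w' 1)) with hξ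
  set k := w 2 / w 1 * ((w 1 * w' 0 - w 0 * w' 1) / w 1) with hk
  have hk0 : k ≠ 0 := mul_ne_zero (div_ne_zero h2 h1) (div_ne_zero hm h1)
  have e1 : (![w 2 / w 1 * w 0, w 2 / w 1 * w 1, w 2] : Fin 3 → ℂ) = w 2 • ![w 0 / w 1, 1, 1] := by
    funext i
    fin_cases i <;> simp <;> field_simp
  -- The second line is replaced, modulo the first one, by the vertical line x = -ξ through the same
  -- point; this requires the point not to be at infinity.
  have e2 : (![w 2 / w 1 * w' 0, w 2 / w 1 * w' 1, w' 2] : Fin 3 → ℂ) =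
      k • ![1, 0, ξ] + (w 2 / w 1 * w' 1) • ![w 0 / w 1, 1, 1] := by
    funext i
    fin_cases i
    · simp [hk]; field_simp; ring
    · simp
    · simp [hk, hξ]; field_simp; ring
  rw [e1, e2, Matrix.mulVec_smul, tangent_smul_left h2, Matrix.mulVec_add, Matrix.mulVec_smul,
    Matrix.mulVec_smul, tangent_add_smul_right, tangent_smul_right hk0]

/-- A foliation of degree `n` which has more than `n` tangencies with a line is tangent to this
line everywhere. -/
theorem tangent_of_card_lt {u a b : Fin 3 → ℂ} (hdet : u ⬝ᵥ a ⨯₃ b ≠ 0) (S : Finset ℂ)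
    (hS : n < S.card) (h : ∀ s ∈ S, F.Tangent u (s • a + b)) (s : ℂ) :
    F.Tangent u (s • a + b) := by
  let L : Fin 3 → Polynomial ℂ := fun j =>
    Polynomial.C ((u ⨯₃ b) j) + Polynomial.X * Polynomial.C ((u ⨯₃ a) j)
  -- The points of the line are parametrized by x(s) = s (u × a) + u × b, and `Q c` is the value of
  -- the form at x(s) on the vector u × c.
  let Q : (Fin 3 → ℂ) → Polynomial ℂ := fun c =>
    ∑ i, MvPolynomial.aeval L (F.coeff i) * Polynomial.C ((u ⨯₃ c) i)
  have hQ : ∀ c s, (Q c).eval s = F.valueAt (u ⨯₃ (s • a + b)) ⬝ᵥ (u ⨯₃ c) := by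
    intro c s
    have : ∀ i, (MvPolynomial.aeval L (F.coeff i)).eval s = F.valueAt (u ⨯₃ (s • a + b)) i := by
      intro i
      have h : (Polynomial.evalRingHom s).comp (MvPolynomial.aeval L).toRingHom =
          MvPolynomial.eval (u ⨯₃ (s • a + b)) := by
        refine MvPolynomial.ringHom_ext (fun c => by simp [Polynomial.algebraMap_eq]) fun j => ?_
        simp only [L, map_add, map_smul]
        simp
        ring
      exact RingHom.congr_fun h (F.coeff i)
    simp only [Q, Polynomial.eval_finsetSum, Polynomial.eval_mul, Polynomial.eval_C, this,
      dotProduct]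
  have heul : ∀ s, s * (Q a).eval s + (Q b).eval s = 0 := by
    intro s
    rw [hQ, hQ, ← smul_eq_mul, ← dotProduct_smul, ← dotProduct_add, ← map_smul, ← map_add]
    exact F.valueAt_dotProduct _
  -- The vector Ω(x) × u is always orthogonal to `u`; as `u`, `a`, `b` are a basis, it vanishes once
  -- it is orthogonal to `a` and `b`, and the Euler relation s Q_a + Q_b = 0 gives the second from
  -- the first.
  have hiff : ∀ s, F.Tangent u (s • a + b) ↔ (Q a).eval s = 0 := by
    intro s
    have hs := heul s
    rw [hQ, hQ] at hs
    rw [hQ]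
    unfold Tangent
    set x := F.valueAt (u ⨯₃ (s • a + b))
    have perm : ∀ c, x ⬝ᵥ u ⨯₃ c = c ⬝ᵥ x ⨯₃ u := fun c => by
      rw [triple_product_permutation, triple_product_permutation]
    constructor
    · intro h0
      rw [perm, h0, dotProduct_zero]
    · intro h0
      rw [h0, mul_zero, zero_add] at hs
      rw [triple_product_eq_det] at hdet
      refine Matrix.eq_zero_of_mulVec_eq_zero hdet ?_
      funext i
      fin_cases i
      · exact dot_cross_self x u
      · exact (perm a).symm.trans h0
      · exact (perm b).symm.trans hs
  have hXQ : Polynomial.X * Q a = -Q b := by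
    refine Polynomial.funext fun s => ?_
    have := heul s
    simp only [Polynomial.eval_mul, Polynomial.eval_X, Polynomial.eval_neg]
    linear_combination this
  have hL : ∀ j, (L j).natDegree ≤ 1 := by
    intro j
    simp only [L]
    compute_degree
  have hdeg : (Q b).natDegree ≤ n + 1 := by
    refine Polynomial.natDegree_sum_le_of_forall_le _ _ fun i _ => ?_
    refine (Polynomial.natDegree_mul_C_le _ _).trans ?_
    have := MvPolynomial.aeval_natDegree_le (F.coeff i) (F.homogeneous i).totalDegree_le L hL
    simpa using this
  -- Q_b has degree at most n + 1 and equals -s Q_a, so Q_a has degree at most n, fewer than the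
  -- number of its roots in `S`.
  have hzero : Q a = 0 := by
    by_contra hne
    have h1 : (Q a).natDegree + 1 ≤ n + 1 := by
      rw [← Polynomial.natDegree_X_mul hne, hXQ, Polynomial.natDegree_neg]
      exact hdeg
    refine hne (Polynomial.eq_zero_of_natDegree_lt_card_of_eval_eq_zero' (Q a) S
      (fun s hs => (hiff s).1 (h s hs)) (by omega))
  rw [hiff, hzero, Polynomial.eval_zero]

end PlaneFoliation

/-! ### Generic lines -/

/-- A polynomial vanishing on a plane is divisible by the linear form defining this plane. -/
theorem linearForm_dvd {a : Fin 3 → ℂ} (ha : a ≠ 0) (p : MvPolynomial (Fin 3) ℂ)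
    (h : ∀ x, a ⬝ᵥ x = 0 → MvPolynomial.eval x p = 0) : linearForm a ∣ p := by
  obtain ⟨i, hi⟩ : ∃ i, a i ≠ 0 := Function.ne_iff.1 ha
  -- The projection onto the plane along the `i`-th axis. Composing `p` with it gives 0, while it is
  -- the identity modulo the linear form.
  let f : Fin 3 → MvPolynomial (Fin 3) ℂ := fun j =>
    MvPolynomial.X j - MvPolynomial.C (if j = i then (a i)⁻¹ else 0) * linearForm a
  have hzero : MvPolynomial.bind₁ f p = 0 := by
    refine MvPolynomial.funext fun x => ?_
    have hc : (MvPolynomial.eval x).comp (MvPolynomial.bind₁ f).toRingHom =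
        MvPolynomial.eval (x - ((a i)⁻¹ * (a ⬝ᵥ x)) • Pi.single i 1) := by
      refine MvPolynomial.ringHom_ext (fun c => by simp) fun j => ?_
      by_cases hj : j = i
      · subst hj
        simp [f, eval_linearForm]
      · simp [f, hj]
    rw [map_zero]
    refine (RingHom.congr_fun hc p).trans (h _ ?_)
    rw [dotProduct_sub, dotProduct_smul, dotProduct_single, smul_eq_mul]
    field_simp
    ring
  have hmk : (Ideal.Quotient.mk (Ideal.span {linearForm a})).comp
      (MvPolynomial.bind₁ f).toRingHom = Ideal.Quotient.mk (Ideal.span {linearForm a}) := by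
    refine MvPolynomial.ringHom_ext (fun c => by simp) fun j => ?_
    have h0 : Ideal.Quotient.mk (Ideal.span {linearForm a}) (linearForm a) = 0 :=
      Ideal.Quotient.eq_zero_iff_mem.2 (Ideal.mem_span_singleton_self _)
    simp [f, h0]
  rw [← Ideal.mem_span_singleton, ← Ideal.Quotient.eq_zero_iff_mem, ← RingHom.congr_fun hmk p]
  simpa using congrArg (Ideal.Quotient.mk (Ideal.span {linearForm a})) hzero

theorem not_isUnit_linearForm (a : Fin 3 → ℂ) : ¬IsUnit (linearForm a) := by
  intro h
  have := h.map (MvPolynomial.eval (0 : Fin 3 → ℂ))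
  rw [eval_linearForm, dotProduct_zero] at this
  exact not_isUnit_zero this

/-- The defining form of a foliation does not vanish identically on a plane. -/
theorem PlaneFoliation.exists_valueAt_ne_zero {n : ℕ} (F : PlaneFoliation n) {a : Fin 3 → ℂ}
    (ha : a ≠ 0) : ∃ x, a ⬝ᵥ x = 0 ∧ F.valueAt x ≠ 0 := by
  by_contra! h
  refine not_isUnit_linearForm a (F.coprime _ fun i => linearForm_dvd ha _ fun x hx => ?_)
  exact congrFun (h x hx) i

/-- The homogeneous coordinates of the line `z` of an affine chart of the dual plane. -/
def chartPoint (M : Matrix (Fin 3) (Fin 3) ℂ) (z : ℂ × ℂ) : Fin 3 → ℂ := M *ᵥ ![z.1, z.2, 1]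

/-- The direction `v` at a point of an affine chart of the dual plane, in homogeneous
coordinates. -/
def chartDir (M : Matrix (Fin 3) (Fin 3) ℂ) (v : ℂ × ℂ) : Fin 3 → ℂ := M *ᵥ ![v.1, v.2, 0]

theorem chartPoint_apply (M : Matrix (Fin 3) (Fin 3) ℂ) (z : ℂ × ℂ) (i : Fin 3) :
    chartPoint M z i = M i 0 * z.1 + M i 1 * z.2 + M i 2 := by
  simp [chartPoint, Matrix.mulVec, dotProduct, Fin.sum_univ_three]

theorem chartDir_apply (M : Matrix (Fin 3) (Fin 3) ℂ) (v : ℂ × ℂ) (i : Fin 3) :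
    chartDir M v i = M i 0 * v.1 + M i 1 * v.2 := by
  simp [chartDir, Matrix.mulVec, dotProduct, Fin.sum_univ_three]

theorem chartDir_smul_add (M : Matrix (Fin 3) (Fin 3) ℂ) (c : ℂ) (v v' : ℂ × ℂ) :
    chartDir M (c • v + v') = c • chartDir M v + chartDir M v' := by
  funext i
  simp only [Pi.add_apply, Pi.smul_apply, chartDir_apply, Prod.fst_add, Prod.snd_add,
    Prod.smul_fst, Prod.smul_snd, smul_eq_mul]
  ring

theorem hasFDerivAt_chartPoint (M : Matrix (Fin 3) (Fin 3) ℂ) (z : ℂ × ℂ) (i : Fin 3) :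
    HasFDerivAt (fun w => chartPoint M w i)
      (M i 0 • ContinuousLinearMap.fst ℂ ℂ ℂ + M i 1 • ContinuousLinearMap.snd ℂ ℂ ℂ) z := by
  simp only [chartPoint_apply]
  exact ((hasFDerivAt_fst.const_mul (M i 0)).add (hasFDerivAt_snd.const_mul (M i 1))).add_const _

theorem analyticAt_chartPoint (M : Matrix (Fin 3) (Fin 3) ℂ) (z : ℂ × ℂ) (i : Fin 3) :
    AnalyticAt ℂ (fun w => chartPoint M w i) z := by
  simp only [chartPoint_apply]
  exact ((analyticAt_const.mul analyticAt_fst).add (analyticAt_const.mul analyticAt_snd)).add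
    analyticAt_const

/-- The points of an affine chart at which a homogeneous polynomial does not vanish are dense. -/
theorem dense_eval_chartPoint_ne_zero {M : Matrix (Fin 3) (Fin 3) ℂ} (hM : M.det ≠ 0)
    {p : MvPolynomial (Fin 3) ℂ} (hp : p ≠ 0)
    (hhom : ∀ (c : ℂ) (x : Fin 3 → ℂ), c ≠ 0 → MvPolynomial.eval x p ≠ 0 →
      MvPolynomial.eval (c • x) p ≠ 0) :
    Dense {z | MvPolynomial.eval (chartPoint M z) p ≠ 0} := by
  have hu : IsUnit M.det := isUnit_iff_ne_zero.2 hM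
  obtain ⟨z₁, hz₁⟩ : ∃ z₁, MvPolynomial.eval (chartPoint M z₁) p ≠ 0 := by
    have hrow : M⁻¹ 2 ≠ 0 := by
      intro h
      have : (M⁻¹).det = 0 := Matrix.det_eq_zero_of_row_eq_zero 2 fun j => congrFun h j
      rw [Matrix.det_nonsing_inv] at this
      exact (Ring.inverse_unit hu.unit ▸ hu.unit⁻¹.ne_zero : Ring.inverse M.det ≠ 0) this
    -- A vector represents a point of the chart when the last coordinate of M⁻¹x is nonzero; the
    -- extra linear factor ensures this.
    have hne := mul_ne_zero hp (linearForm_ne_zero hrow)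
    obtain ⟨x, hx⟩ : ∃ x, MvPolynomial.eval x (p * linearForm (M⁻¹ 2)) ≠ 0 := by
      by_contra! h
      exact hne (MvPolynomial.funext fun x => by rw [h, map_zero])
    rw [map_mul, eval_linearForm] at hx
    set y := M⁻¹ *ᵥ x with hy
    have hy2 : y 2 ≠ 0 := right_ne_zero_of_mul hx
    refine ⟨(y 0 / y 2, y 1 / y 2), ?_⟩
    have : chartPoint M (y 0 / y 2, y 1 / y 2) = (y 2)⁻¹ • x := by
      have hxy : x = M *ᵥ y := by
        rw [hy, Matrix.mulVec_mulVec, Matrix.mul_nonsing_inv _ hu, Matrix.one_mulVec]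
      rw [hxy, ← Matrix.mulVec_smul, chartPoint]
      congr 1
      funext i
      fin_cases i <;> simp [div_eq_inv_mul, hy2]
    rw [this]
    exact hhom _ _ (inv_ne_zero hy2) (left_ne_zero_of_mul hx)
  have han : AnalyticOnNhd ℂ (fun z => MvPolynomial.eval (chartPoint M z) p) Set.univ :=
    fun z _ => AnalyticAt.aeval_mvPolynomial (f := chartPoint M)
      (fun i => analyticAt_chartPoint M z i) p
  intro z₀
  rw [mem_closure_iff_frequently]
  by_contra h
  -- The identity theorem: vanishing near one point would force vanishing at `z₁`.
  have hev : (fun z => MvPolynomial.eval (chartPoint M z) p) =ᶠ[𝓝 z₀] 0 := by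
    filter_upwards [not_frequently.1 h] with z hz
    simpa using hz
  exact hz₁ (han.eqOn_zero_of_preconnected_of_eventuallyEq_zero isPreconnected_univ
    (Set.mem_univ z₀) hev (Set.mem_univ z₁))

/-- For `w` outside a proper homogeneous hypersurface, the line with coordinates `w` in the chart
`g` is not tangent to the foliation at its point at infinity. -/
theorem PlaneFoliation.exists_polynomial_not_tangent {n : ℕ} (F : PlaneFoliation n)
    (g : GL (Fin 3) ℂ) : ∃ p : MvPolynomial (Fin 3) ℂ, p ≠ 0 ∧
      (∀ (c : ℂ) (x : Fin 3 → ℂ), c ≠ 0 → MvPolynomial.eval x p ≠ 0 →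
        MvPolynomial.eval (c • x) p ≠ 0) ∧
      ∀ w, MvPolynomial.eval w p ≠ 0 → w 1 ≠ 0 ∧ w 2 ≠ 0 ∧
        ∀ w', w 1 * w' 0 - w 0 * w' 1 = 0 → w ⨯₃ w' ≠ 0 →
          ¬F.Tangent (g.1ᵀ *ᵥ w) (g.1ᵀ *ᵥ w') := by
  -- `A` sends the line w to its point at infinity (-w₁, w₀, 0), read in the coordinates X.
  let A : Matrix (Fin 3) (Fin 3) ℂ := (g⁻¹ : GL (Fin 3) ℂ).1 * !![0, -1, 0; 1, 0, 0; 0, 0, 0]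
  let V : (Fin 3 → ℂ) → Fin 3 → ℂ := fun w => F.valueAt (A *ᵥ w) ⨯₃ (g.1ᵀ *ᵥ w)
  let E : Fin 3 → MvPolynomial (Fin 3) ℂ :=
    (fun i => MvPolynomial.bind₁ (fun k => linearForm (A k)) (F.coeff i)) ⨯₃
      (fun i => linearForm (g.1ᵀ i))
  have hE : ∀ j w, MvPolynomial.eval w (E j) = V w j := by
    intro j w
    have hT : ∀ i, (g.1ᵀ *ᵥ w) i = g.1ᵀ i ⬝ᵥ w := fun i => rfl
    fin_cases j <;>
    simp [E, V, cross_apply, eval_bind₁_linearForm, eval_linearForm, PlaneFoliation.valueAt,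
      hT]
  have hVhom : ∀ (c : ℂ) w, V (c • w) = c ^ (n + 2) • V w := by
    intro c w
    simp only [V]
    rw [Matrix.mulVec_smul, Matrix.mulVec_smul, F.valueAt_smul, LinearMap.map_smul₂, map_smul,
      smul_smul]
    congr 1
  have hgg' : (g⁻¹ : GL (Fin 3) ℂ).1 * g.1 = 1 := by
    rw [← Units.val_mul, inv_mul_cancel, Units.val_one]
  obtain ⟨j, hj⟩ : ∃ j, E j ≠ 0 := by
    by_contra! h
    -- At a point x of the line at infinity where the form is nonzero, the form would be
    -- proportional to every line in a family through x containing two distinct lines, which is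
    -- impossible.
    obtain ⟨x, hx, hFx⟩ := F.exists_valueAt_ne_zero (row_ne_zero g)
    set y := g.1 *ᵥ x with hy
    have hy2 : y 2 = 0 := hx
    have hxy : ∀ r, A *ᵥ ![y 1, -y 0, r] = x := by
      intro r
      have e1 : !![0, -1, 0; 1, 0, 0; 0, 0, 0] *ᵥ ![y 1, -y 0, r] = y := by
        funext i
        fin_cases i <;> simp [Matrix.mulVec, dotProduct, Fin.sum_univ_three, hy2]
      rw [← Matrix.mulVec_mulVec, e1, hy, Matrix.mulVec_mulVec, hgg', Matrix.one_mulVec]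
    have hV : ∀ r, F.valueAt x ⨯₃ (g.1ᵀ *ᵥ ![y 1, -y 0, r]) = 0 := by
      intro r
      funext i
      have := hE i ![y 1, -y 0, r]
      rw [h, map_zero] at this
      simp only [V, hxy] at this
      exact this.symm
    have hy0 : y 0 ≠ 0 ∨ y 1 ≠ 0 := by
      by_contra! h0
      have : y = 0 := by
        funext i
        fin_cases i
        exacts [h0.1, h0.2, hy2]
      apply hFx
      have hx0 : x = (0 : ℂ) • x := by
        rw [zero_smul]
        exact Matrix.eq_zero_of_mulVec_eq_zero (PlaneFoliation.det_ne_zero g) this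
      rw [hx0, F.valueAt_smul]
      simp
    obtain ⟨b, hb⟩ : ∃ b, F.valueAt x = g.1ᵀ *ᵥ b := by
      refine ⟨((g⁻¹ : GL (Fin 3) ℂ).1)ᵀ *ᵥ F.valueAt x, ?_⟩
      rw [Matrix.mulVec_mulVec, ← Matrix.transpose_mul, hgg', Matrix.transpose_one,
        Matrix.one_mulVec]
    have hb' : ∀ r, b ⨯₃ ![y 1, -y 0, r] = 0 := fun r => by
      rw [← cross_mulVec_eq_zero_iff (PlaneFoliation.det_ne_zero g), ← hb]
      exact hV r
    have c0 := hb' 0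
    have c1 := hb' 1
    have hb0 : b = 0 := by
      simp only [cross_apply] at c0 c1
      have p0 := congrFun c0 0
      have p1 := congrFun c0 1
      have q0 := congrFun c1 0
      have q1 := congrFun c1 1
      simp at p0 p1 q0 q1
      have b2 : b 2 = 0 := by
        rcases hy0 with h0 | h0
        · exact p0.resolve_right h0
        · exact p1.resolve_right h0
      have b1 : b 1 = 0 := by simpa [b2] using q0
      have b0 : b 0 = 0 := by simpa [b2] using q1
      funext i
      fin_cases i
      exacts [b0, b1, b2]
    exact hFx (by rw [hb, hb0, Matrix.mulVec_zero])
  have heval : ∀ w, MvPolynomial.eval w (MvPolynomial.X 1 * MvPolynomial.X 2 * E j) =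
      w 1 * w 2 * V w j := by
    intro w
    simp [hE]
  -- The factors X₁ and X₂ exclude vertical lines and lines through the origin of the chart.
  refine ⟨MvPolynomial.X 1 * MvPolynomial.X 2 * E j,
    mul_ne_zero (mul_ne_zero (MvPolynomial.X_ne_zero _) (MvPolynomial.X_ne_zero _)) hj, ?_, ?_⟩
  · intro c x hc hx
    rw [heval] at hx ⊢
    rw [hVhom]
    simp only [Pi.smul_apply, smul_eq_mul, ne_eq, mul_eq_zero, not_or,
      hc, not_false_eq_true, true_and] at hx ⊢
    exact ⟨hx.1, pow_ne_zero _ hc, hx.2⟩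
  · intro w hw
    rw [heval] at hw
    have hw1 := left_ne_zero_of_mul (left_ne_zero_of_mul hw)
    have hw2 := right_ne_zero_of_mul (left_ne_zero_of_mul hw)
    have hVw := right_ne_zero_of_mul hw
    refine ⟨hw1, hw2, fun w' hm hcross ht => hVw ?_⟩
    -- the common point of the two lines is on the line at infinity
    set c := (w 2 * w' 1 - w 1 * w' 2) / w 1 with hc
    have hcr : w ⨯₃ w' = c • ![-w 1, w 0, 0] := by
      funext i
      fin_cases i
      · simp [cross_apply, hc]; field_simp; ring
      · simp [cross_apply, hc]; field_simp; linear_combination w 2 * hm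
      · simp [cross_apply]; linear_combination -hm
    have hc0 : c ≠ 0 := by
      intro h
      exact hcross (by rw [hcr, h, zero_smul])
    have hA : A *ᵥ w = (g⁻¹ : GL (Fin 3) ℂ).1 *ᵥ ![-w 1, w 0, 0] := by
      rw [← Matrix.mulVec_mulVec]
      congr 1
      funext i
      fin_cases i <;> simp [Matrix.mulVec, dotProduct, Fin.sum_univ_three]
    have hm' : (g.1ᵀ *ᵥ w) ⨯₃ (g.1ᵀ *ᵥ w') = (g.1.det * c) • (A *ᵥ w) := by
      have h1 := mulVec_cross g.1 w w'
      have h2 := congrArg ((g⁻¹ : GL (Fin 3) ℂ).1 *ᵥ ·) h1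
      simp only [Matrix.mulVec_mulVec, hgg', Matrix.one_mulVec] at h2
      rw [h2, hcr, hA, Matrix.mulVec_smul, Matrix.mulVec_smul, smul_smul]
    unfold PlaneFoliation.Tangent at ht
    rw [hm', F.valueAt_smul, LinearMap.map_smul₂, smul_eq_zero_iff_right
      (pow_ne_zero _ (mul_ne_zero (PlaneFoliation.det_ne_zero g) hc0))] at ht
    exact congrFun ht j

/-! ### The dual webs in a chart -/

theorem triple_product_mulVec (N : Matrix (Fin 3) (Fin 3) ℂ) (x y z : Fin 3 → ℂ) :
    (N *ᵥ x) ⬝ᵥ (N *ᵥ y) ⨯₃ (N *ᵥ z) = N.det * (x ⬝ᵥ y ⨯₃ z) := by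
  simp [cross_apply, Matrix.mulVec, dotProduct, Fin.sum_univ_three, Matrix.det_fin_three]
  ring

theorem pairing_eq_zero_of_wedge_eq_zero {a b v : ℂ × ℂ} (hb : b ≠ 0) (h : wedge a b = 0)
    (hv : b.1 * v.1 + b.2 * v.2 = 0) : a.1 * v.1 + a.2 * v.2 = 0 := by
  simp only [wedge] at h
  by_cases h1 : b.1 = 0
  · have h2 : b.2 ≠ 0 := fun h2 => hb (Prod.ext h1 h2)
    have : b.2 * (a.1 * v.1 + a.2 * v.2) = 0 := by linear_combination v.1 * h + a.2 * hv
    exact (mul_eq_zero.1 this).resolve_left h2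
  · have : b.1 * (a.1 * v.1 + a.2 * v.2) = 0 := by linear_combination a.1 * hv - v.2 * h
    exact (mul_eq_zero.1 this).resolve_left h1

theorem wedge_eq_zero_of_pairing_eq_zero {a b v : ℂ × ℂ} (hv : v ≠ 0)
    (ha : a.1 * v.1 + a.2 * v.2 = 0) (hb : b.1 * v.1 + b.2 * v.2 = 0) : wedge a b = 0 := by
  refine wedge_eq_zero_of_common (c := kerVec v) (kerVec_ne_zero hv) ?_ ?_
  · simp only [wedge, kerVec]; linear_combination -ha
  · simp only [wedge, kerVec]; linear_combination -hb

theorem exists_eq_smul_kerVec {a v : ℂ × ℂ} (ha : a ≠ 0) (hv : v ≠ 0)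
    (h : a.1 * v.1 + a.2 * v.2 = 0) : ∃ c : ℂ, c ≠ 0 ∧ v = c • kerVec a := by
  suffices ∃ c : ℂ, v = c • kerVec a by
    obtain ⟨c, hc⟩ := this
    exact ⟨c, fun h0 => hv (by rw [hc, h0, zero_smul]), hc⟩
  by_cases h1 : a.1 = 0
  · have h2 : a.2 ≠ 0 := fun h2 => ha (Prod.ext h1 h2)
    refine ⟨v.1 / a.2, ?_⟩
    ext
    · simp [kerVec, h2]
    · simpa [h1, kerVec, h2] using h
  · refine ⟨-v.2 / a.1, ?_⟩
    ext
    · simp only [kerVec, Prod.smul_fst, smul_eq_mul]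
      field_simp
      linear_combination h
    · simp only [kerVec, Prod.smul_snd, smul_eq_mul]
      field_simp

section Webs

variable {n : ℕ} (F : PlaneFoliation n) (g : GL (Fin 3) ℂ) (M : Matrix (Fin 3) (Fin 3) ℂ)

/-- The equation of the direction, at the line `z`, of the pencil of lines through the point at
infinity of this line. -/
def pencilForm (z : ℂ × ℂ) : ℂ × ℂ :=
  (chartPoint M z 1 * M 0 0 - chartPoint M z 0 * M 1 0,
    chartPoint M z 1 * M 0 1 - chartPoint M z 0 * M 1 1)

/-- Tangency of the foliation in the direction `v` at the point `z` of a chart of the dual plane. -/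
def ChartTangent (z v : ℂ × ℂ) : Prop :=
  F.Tangent (g.1ᵀ *ᵥ chartPoint M z) (g.1ᵀ *ᵥ chartDir M v)

/-- The dual web of a foliation, in a chart. -/
def dualWeb (z : ℂ × ℂ) : Set (ℂ × ℂ) := {v | v ≠ 0 ∧ ChartTangent F g M z v}

/-- The dual web of a foliation together with the line at infinity, in a chart. -/
def boxDualWeb (z : ℂ × ℂ) : Set (ℂ × ℂ) :=
  {v | v ≠ 0 ∧ ((pencilForm M z).1 * v.1 + (pencilForm M z).2 * v.2 = 0 ∨ ChartTangent F g M z v)}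

theorem pairing_pencilForm (z v : ℂ × ℂ) :
    (pencilForm M z).1 * v.1 + (pencilForm M z).2 * v.2 =
      chartPoint M z 1 * chartDir M v 0 - chartPoint M z 0 * chartDir M v 1 := by
  simp only [pencilForm, chartDir_apply]; ring

theorem analyticAt_pencilForm (z : ℂ × ℂ) : AnalyticAt ℂ (pencilForm M) z := by
  have h0 := analyticAt_chartPoint M z 0
  have h1 := analyticAt_chartPoint M z 1
  exact ((h1.mul analyticAt_const).sub (h0.mul analyticAt_const)).prod
    ((h1.mul analyticAt_const).sub (h0.mul analyticAt_const))

/-- The change of coordinates from a chart of the dual plane to the coordinates `g`. -/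
def chartMatrix (h : GL (Fin 3) ℂ) : Matrix (Fin 3) (Fin 3) ℂ := ((g⁻¹ : GL (Fin 3) ℂ).1)ᵀ * h.1

theorem transpose_mulVec_chartMatrix (h : GL (Fin 3) ℂ) (x : Fin 3 → ℂ) :
    g.1ᵀ *ᵥ (chartMatrix g h *ᵥ x) = h.1 *ᵥ x := by
  have : (g⁻¹ : GL (Fin 3) ℂ).1 * g.1 = 1 := by
    rw [← Units.val_mul, inv_mul_cancel, Units.val_one]
  rw [chartMatrix, Matrix.mulVec_mulVec, ← mul_assoc, ← Matrix.transpose_mul, this,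
    Matrix.transpose_one, one_mul]

theorem det_chartMatrix_ne_zero (h : GL (Fin 3) ℂ) : (chartMatrix g h).det ≠ 0 := by
  rw [chartMatrix, Matrix.det_mul, Matrix.det_transpose]
  exact mul_ne_zero (PlaneFoliation.det_ne_zero _) (PlaneFoliation.det_ne_zero _)

theorem leg_toPre (h : GL (Fin 3) ℂ) : F.toPre.leg h = dualWeb F g (chartMatrix g h) := by
  funext z
  ext v
  have hform : ∀ x, F.toPre.formAt x = F.valueAt x := by
    intro x
    funext i
    simp [PlanePreFoliation.formAt, PlaneFoliation.toPre, PlaneFoliation.valueAt]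
  simp only [PlanePreFoliation.leg, dualWeb, ChartTangent, chartPoint, chartDir,
    transpose_mulVec_chartMatrix, PlaneFoliation.Tangent, hform]

theorem leg_lineAtInfinityBox (h : GL (Fin 3) ℂ) :
    (F.lineAtInfinityBox g).leg h = boxDualWeb F g (chartMatrix g h) := by
  funext z
  ext v
  simp only [PlanePreFoliation.leg, boxDualWeb, Set.mem_ofPred_eq]
  refine and_congr_right fun _ => ?_
  rw [← transpose_mulVec_chartMatrix g h, ← transpose_mulVec_chartMatrix g h]
  change _ ↔ _ ∨ (F.valueAt _ ⨯₃ _ = 0)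
  have hform : ∀ x, (F.lineAtInfinityBox g).formAt x = (g.1 2 ⬝ᵥ x) • F.valueAt x := by
    intro x
    funext i
    simp [PlanePreFoliation.formAt, PlaneFoliation.lineAtInfinityBox, PlaneFoliation.valueAt,
      eval_linearForm]
  rw [hform, LinearMap.map_smul₂, smul_eq_zero, pairing_pencilForm]
  refine or_congr ?_ Iff.rfl
  -- The last chart coordinate of the common point of two lines w, w' is det g times the last entry
  -- of w × w', which is minus the pairing with `pencilForm`.
  have h2 := congrFun (mulVec_cross g.1 (chartPoint (chartMatrix g h) z)
    (chartDir (chartMatrix g h) v)) 2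
  simp only [Pi.smul_apply, smul_eq_mul] at h2
  change (g.1 *ᵥ _) 2 = 0 ↔ _
  refine (Eq.congr_left h2).trans ?_
  rw [mul_eq_zero, or_iff_right (PlaneFoliation.det_ne_zero g), ← neg_eq_zero]
  simp [cross_apply]

variable {F g M}

theorem chartTangent_smul_iff {z v : ℂ × ℂ} {c : ℂ} (hc : c ≠ 0) :
    ChartTangent F g M z (c • v) ↔ ChartTangent F g M z v := by
  have : chartDir M (c • v) = c • chartDir M v := by
    funext i
    simp only [Pi.smul_apply, chartDir_apply, Prod.smul_fst, Prod.smul_snd, smul_eq_mul]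
    ring
  rw [ChartTangent, this, Matrix.mulVec_smul, PlaneFoliation.tangent_smul_right hc, ChartTangent]

/-- At a regular point of the web of `L_∞ ⊠ F`, exactly one of the foliations of the web is the
pencil, and the other ones define the web of `F`. -/
theorem IsDecomposition.exists_pencil (hM : M.det ≠ 0) {U : Set (ℂ × ℂ)}
    {ω : Fin (n + 1) → ℂ × ℂ → ℂ × ℂ} (hω : IsDecomposition (n + 1) (boxDualWeb F g M) U ω)
    {z : ℂ × ℂ} (hz : z ∈ U) : pencilForm M z ≠ 0 ∧ ∃ k, wedge (ω k z) (pencilForm M z) = 0 ∧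
      ∀ v, v ≠ 0 → (v ∈ dualWeb F g M z ↔
        ∃ i, (ω (k.succAbove i) z).1 * v.1 + (ω (k.succAbove i) z).2 * v.2 = 0) := by
  -- A direction (1, s) outside the web. It shows that `pencilForm` is nonzero, and the vectors c(1,
  -- s) + (0, 1) then represent every other direction.
  obtain ⟨s, hs⟩ := Infinite.exists_notMem_finset
    (Finset.univ.image fun i => -(ω i z).1 / (ω i z).2)
  have ha : ∀ i, (ω i z).1 + (ω i z).2 * s ≠ 0 := by
    intro i h
    by_cases h2 : (ω i z).2 = 0
    · rw [h2, zero_mul, add_zero] at h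
      exact hω.ne_zero i z hz (Prod.ext h h2)
    · refine hs (Finset.mem_image.2 ⟨i, Finset.mem_univ _, ?_⟩)
      field_simp
      linear_combination -h
  have ha0 : ((1, s) : ℂ × ℂ) ≠ 0 := fun h => one_ne_zero (congrArg Prod.fst h)
  have haW : ((1, s) : ℂ × ℂ) ∉ boxDualWeb F g M z := by
    rw [hω.directions z hz _ ha0]
    rintro ⟨i, hi⟩
    exact ha i (by simpa using hi)
  have hp0 : pencilForm M z ≠ 0 := fun h => haW ⟨ha0, Or.inl (by simp [h])⟩
  refine ⟨hp0, ?_⟩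
  obtain ⟨k, hk⟩ := (hω.kerVec_mem_iff hz hp0).1
    ⟨kerVec_ne_zero hp0, Or.inl (by simp only [kerVec]; ring)⟩
  refine ⟨k, hk, ?_⟩
  -- If the pencil direction were also a tangency direction, all n + 1 directions of the web would
  -- be tangencies of `F`, hence every direction would be one, whereas the web has only finitely
  -- many.
  have hpencil : ∀ v, v ≠ 0 → (pencilForm M z).1 * v.1 + (pencilForm M z).2 * v.2 = 0 →
      ¬ChartTangent F g M z v := by
    intro v₀ hv₀ hpv₀ ht₀
    obtain ⟨c₀, hc₀, rfl⟩ := exists_eq_smul_kerVec hp0 hv₀ hpv₀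
    rw [chartTangent_smul_iff hc₀] at ht₀
    have hall : ∀ v ∈ boxDualWeb F g M z, ChartTangent F g M z v := by
      rintro v ⟨hv, hpv | ht⟩
      · obtain ⟨c, hc, rfl⟩ := exists_eq_smul_kerVec hp0 hv hpv
        rwa [chartTangent_smul_iff hc]
      · exact ht
    -- The parameter c for which c(1, s) + (0, 1) lies in the kernel of `ω i`.
    let σ : Fin (n + 1) → ℂ := fun i => -(ω i z).2 / ((ω i z).1 + (ω i z).2 * s)
    have hne : ∀ c : ℂ, c • ((1, s) : ℂ × ℂ) + (0, 1) ≠ 0 := by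
      intro c h
      have h1 : c = 0 := by simpa using congrArg Prod.fst h
      have h2 := congrArg Prod.snd h
      simp [h1] at h2
    have hσ : ∀ i (c : ℂ), (ω i z).1 * (c • ((1, s) : ℂ × ℂ) + (0, 1)).1 +
        (ω i z).2 * (c • ((1, s) : ℂ × ℂ) + (0, 1)).2 = 0 ↔ c = σ i := by
      intro i c
      have := ha i
      simp only [Prod.fst_add, Prod.snd_add, Prod.smul_mk, smul_eq_mul, σ]
      rw [eq_div_iff this]
      constructor <;> intro h <;> linear_combination h
    have hσinj : Function.Injective σ := by
      intro i j hij
      by_contra h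
      exact hω.transverse i j h z hz (wedge_eq_zero_of_pairing_eq_zero (hne (σ i))
        ((hσ i _).2 rfl) ((hσ j _).2 hij))
    have hmem : ∀ c : ℂ, c • ((1, s) : ℂ × ℂ) + (0, 1) ∈ boxDualWeb F g M z ↔ ∃ i, c = σ i := by
      intro c
      rw [hω.directions z hz _ (hne c)]
      exact exists_congr fun i => hσ i c
    have hdir : ∀ c : ℂ, ChartTangent F g M z (c • ((1, s) : ℂ × ℂ) + (0, 1)) ↔
        F.Tangent (g.1ᵀ *ᵥ chartPoint M z)
          (c • (g.1ᵀ *ᵥ chartDir M (1, s)) + g.1ᵀ *ᵥ chartDir M (0, 1)) := by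
      intro c
      rw [ChartTangent, chartDir_smul_add, Matrix.mulVec_add, Matrix.mulVec_smul]
    have hdet : (g.1ᵀ *ᵥ chartPoint M z) ⬝ᵥ
        (g.1ᵀ *ᵥ chartDir M (1, s)) ⨯₃ (g.1ᵀ *ᵥ chartDir M (0, 1)) ≠ 0 := by
      rw [triple_product_mulVec, chartPoint, chartDir, chartDir, triple_product_mulVec]
      refine mul_ne_zero ?_ (mul_ne_zero hM ?_)
      · rw [Matrix.det_transpose]
        exact PlaneFoliation.det_ne_zero g
      · simp [cross_apply]
    have htan := PlaneFoliation.tangent_of_card_lt (F := F) hdet (Finset.univ.image σ)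
      (by rw [Finset.card_image_of_injective _ hσinj, Finset.card_univ, Fintype.card_fin]; omega)
      (by
        intro c hc
        obtain ⟨i, -, rfl⟩ := Finset.mem_image.1 hc
        exact (hdir _).1 (hall _ ((hmem _).2 ⟨i, rfl⟩)))
    obtain ⟨c, hc⟩ := Infinite.exists_notMem_finset (Finset.univ.image σ)
    obtain ⟨i, hi⟩ := (hmem c).1 ⟨hne c, Or.inr ((hdir c).2 (htan c))⟩
    exact hc (Finset.mem_image.2 ⟨i, Finset.mem_univ _, hi.symm⟩)
  intro v hv
  constructor
  · rintro ⟨-, ht⟩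
    obtain ⟨j, hj⟩ := (hω.directions z hz v hv).1 ⟨hv, Or.inr ht⟩
    have hjk : j ≠ k := by
      rintro rfl
      refine hpencil v hv (pairing_eq_zero_of_wedge_eq_zero (hω.ne_zero j z hz) ?_ hj) ht
      rw [wedge_comm, hk, neg_zero]
    obtain ⟨i, rfl⟩ := Fin.exists_succAbove_eq hjk
    exact ⟨i, hj⟩
  · rintro ⟨i, hi⟩
    obtain ⟨-, hp | ht⟩ := (hω.directions z hz v hv).2 ⟨_, hi⟩
    · exfalso
      refine hω.transverse _ k (Fin.succAbove_ne k i) z hz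
        (wedge_eq_zero_of_pairing_eq_zero hv hi (pairing_eq_zero_of_wedge_eq_zero hp0 hk hp))
    · exact ⟨hv, ht⟩

/-- Near a regular point of the web of `L_∞ ⊠ F`, the web of `F` is obtained by removing the
pencil. -/
theorem IsDecomposition.exists_removePencil (hM : M.det ≠ 0) {U : Set (ℂ × ℂ)}
    {ω : Fin (n + 1) → ℂ × ℂ → ℂ × ℂ} (hω : IsDecomposition (n + 1) (boxDualWeb F g M) U ω)
    {z : ℂ × ℂ} (hz : z ∈ U) : ∃ (k : Fin (n + 1)) (V : Set (ℂ × ℂ)), V ⊆ U ∧ z ∈ V ∧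
      (∀ w ∈ V, wedge (ω k w) (pencilForm M w) = 0) ∧
      (∀ w ∈ V, ∀ i, wedge (ω (k.succAbove i) w) (pencilForm M w) ≠ 0) ∧
      IsDecomposition n (dualWeb F g M) V fun i => ω (k.succAbove i) := by
  obtain ⟨hp0, k, hk, -⟩ := hω.exists_pencil hM hz
  have hev : ∀ᶠ w in 𝓝 z, w ∈ U ∧ ∀ i, wedge (ω (k.succAbove i) w) (pencilForm M w) ≠ 0 := by
    refine (hω.isOpen.eventually_mem hz).and (eventually_all.2 fun i => ?_)
    refine ((hω.analytic _ z hz).wedge (analyticAt_pencilForm M z)).continuousAt.eventually_ne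
      fun h => hω.transverse _ k (Fin.succAbove_ne k i) z hz (wedge_eq_zero_of_common hp0 h hk)
  obtain ⟨V, hV, hVo, hzV⟩ := eventually_nhds_iff.1 hev
  -- The index of the pencil stays equal to `k` on `V`, since the other foliations remain transverse
  -- to it.
  have hk' : ∀ w ∈ V, ∀ j, wedge (ω j w) (pencilForm M w) = 0 → j = k := by
    intro w hw j hj
    by_contra hne
    obtain ⟨i, rfl⟩ := Fin.exists_succAbove_eq hne
    exact (hV w hw).2 i hj
  refine ⟨k, V, fun w hw => (hV w hw).1, hzV, ?_, fun w hw => (hV w hw).2, hVo,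
    fun i w hw => hω.analytic _ w (hV w hw).1, fun i w hw => hω.ne_zero _ w (hV w hw).1,
    fun i j hij w hw => hω.transverse _ _ (Fin.succAbove_right_injective.ne hij) w (hV w hw).1, ?_⟩
  · intro w hw
    obtain ⟨-, j, hj, -⟩ := hω.exists_pencil hM (hV w hw).1
    rwa [hk' w hw j hj] at hj
  · intro w hw v hv
    obtain ⟨-, j, hj, hdir⟩ := hω.exists_pencil hM (hV w hw).1
    rw [hk' w hw j hj] at hdir
    exact hdir v hv

/-- At a point where the pencil is transverse to the web of `F`, it can be added to this web. -/
theorem IsDecomposition.isRegularPoint_boxDualWeb {U : Set (ℂ × ℂ)}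
    {ω : Fin n → ℂ × ℂ → ℂ × ℂ} (hω : IsDecomposition n (dualWeb F g M) U ω) {z : ℂ × ℂ}
    (hz : z ∈ U) (hp : pencilForm M z ≠ 0)
    (ht : ∀ i, wedge (ω i z) (pencilForm M z) ≠ 0) :
    IsRegularPoint (n + 1) (boxDualWeb F g M) z := by
  have hpa := analyticAt_pencilForm M
  have hev : ∀ᶠ w in 𝓝 z, w ∈ U ∧ pencilForm M w ≠ 0 ∧
      ∀ i, wedge (ω i w) (pencilForm M w) ≠ 0 :=
    (hω.isOpen.eventually_mem hz).and (((hpa z).continuousAt.eventually_ne hp).and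
      (eventually_all.2 fun i =>
        ((hω.analytic i z hz).wedge (hpa z)).continuousAt.eventually_ne (ht i)))
  obtain ⟨V, hV, hVo, hzV⟩ := eventually_nhds_iff.1 hev
  refine ⟨V, Fin.cons (pencilForm M) ω, hzV, hVo, ?_, ?_, ?_, ?_⟩
  · intro i
    refine Fin.cases ?_ (fun i => ?_) i
    · exact fun w _ => hpa w
    · exact fun w hw => hω.analytic i w (hV w hw).1
  · intro i w hw
    refine Fin.cases ?_ (fun i => ?_) i
    · exact (hV w hw).2.1
    · exact hω.ne_zero i w (hV w hw).1
  · intro i j hij w hw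
    induction i using Fin.cases with
    | zero =>
      induction j using Fin.cases with
      | zero => exact absurd rfl hij
      | succ j => exact wedge_ne_zero_symm ((hV w hw).2.2 j)
    | succ i =>
      induction j using Fin.cases with
      | zero => exact (hV w hw).2.2 i
      | succ j => exact hω.transverse i j (fun h => hij (by rw [h])) w (hV w hw).1
  · intro w hw v hv
    have hd := hω.directions w (hV w hw).1 v hv
    simp only [dualWeb, Set.mem_ofPred_eq, hv, ne_eq, not_false_eq_true, true_and] at hd
    simp only [boxDualWeb, Set.mem_ofPred_eq, hv, ne_eq, not_false_eq_true, true_and,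
      Fin.exists_fin_succ, Fin.cons_zero, Fin.cons_succ, hd]

end Webs

/-! ### Flatness of the `3`-subwebs containing the pencil -/

theorem dForm_mul {f₁ f₂ : ℂ × ℂ → ℂ} {z : ℂ × ℂ} (h₁ : DifferentiableAt ℂ f₁ z)
    (h₂ : DifferentiableAt ℂ f₂ z) :
    dForm (fun w => f₁ w * f₂ w) z = f₁ z • dForm f₂ z + f₂ z • dForm f₁ z := by
  simp [dForm, fderiv_fun_mul h₁ h₂]

/-- A continuous function with values in a finite set is locally constant. -/
theorem eventually_eq_of_mem_finite {X : Type*} [TopologicalSpace X] {f : X → ℂ} {x : X}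
    (hf : ContinuousAt f x) {T : Set ℂ} (hT : T.Finite) (h : ∀ᶠ y in 𝓝 x, f y ∈ T) :
    ∀ᶠ y in 𝓝 x, f y = f x := by
  have hopen : (T \ {f x})ᶜ ∈ 𝓝 (f x) :=
    (hT.subset Set.sdiff_subset).isClosed.isOpen_compl.mem_nhds fun hx => hx.2 rfl
  filter_upwards [h, hf hopen] with y hy hy'
  by_contra hne
  exact hy' ⟨hy, hne⟩

/-- Two functions which are continuous at a point of the closure of a set on which they agree
agree at this point. -/
theorem eq_of_mem_closure {X : Type*} [TopologicalSpace X] {f f' : X → ℂ} {x : X} {S : Set X}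
    (hf : ContinuousAt f x) (hf' : ContinuousAt f' x) (hx : x ∈ closure S)
    (h : ∀ y ∈ S, f y = f' y) : f x = f' x := by
  have : (𝓝[S] x).NeBot := mem_closure_iff_nhdsWithin_neBot.1 hx
  refine tendsto_nhds_unique_of_eventuallyEq (l := 𝓝[S] x) (hf.tendsto.mono_left nhdsWithin_le_nhds)
    (hf'.tendsto.mono_left nhdsWithin_le_nhds) ?_
  filter_upwards [self_mem_nhdsWithin] with y hy
  exact h y hy

/-- The slope of the line `z`, up to sign. -/
def chartSlope (M : Matrix (Fin 3) (Fin 3) ℂ) (z : ℂ × ℂ) : ℂ :=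
  chartPoint M z 0 * (chartPoint M z 1)⁻¹

/-- The intercept of the line `z`, up to sign. -/
def intercept (M : Matrix (Fin 3) (Fin 3) ℂ) (z : ℂ × ℂ) : ℂ :=
  chartPoint M z 2 * (chartPoint M z 1)⁻¹

/-- The logarithmic differential of the intercept. -/
def dlogIntercept (M : Matrix (Fin 3) (Fin 3) ℂ) (z : ℂ × ℂ) : ℂ × ℂ :=
  (intercept M z)⁻¹ • dForm (intercept M) z

/-- The normalized abscissa of the tangency point of a line with a foliation of its dual web,
defined by `ω`. -/
def abscissa (M : Matrix (Fin 3) (Fin 3) ℂ) (ω : ℂ × ℂ → ℂ × ℂ) (z : ℂ × ℂ) : ℂ :=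
  wedge (dlogIntercept M z) (ω z) / wedge (dForm (chartSlope M) z) (ω z)

/-! ### Slope and intercept as coordinates on the dual plane, and the curvature of the web with the
pencil removed -/

section Chart

variable {M : Matrix (Fin 3) (Fin 3) ℂ} {z : ℂ × ℂ}

theorem dForm_chartPoint (i : Fin 3) :
    dForm (fun w => chartPoint M w i) z = (M i 0, M i 1) := by
  simp [dForm, (hasFDerivAt_chartPoint M z i).fderiv]

theorem dForm_chartPoint_div (h1 : chartPoint M z 1 ≠ 0) (i : Fin 3) :
    dForm (fun w => chartPoint M w i * (chartPoint M w 1)⁻¹) z =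
      (chartPoint M z 1 ^ 2)⁻¹ • (chartPoint M z 1 * M i 0 - chartPoint M z i * M 1 0,
        chartPoint M z 1 * M i 1 - chartPoint M z i * M 1 1) := by
  have d : ∀ i, DifferentiableAt ℂ (fun w => chartPoint M w i) z := fun i =>
    (hasFDerivAt_chartPoint M z i).differentiableAt
  rw [dForm_mul (f₂ := fun w => (chartPoint M w 1)⁻¹) (d i) ((d 1).inv h1), dForm_inv (d 1) h1,
    dForm_chartPoint, dForm_chartPoint]
  ext
  · simp only [Prod.smul_mk, Prod.mk_add_mk, smul_eq_mul]
    field_simp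
    ring
  · simp only [Prod.smul_mk, Prod.mk_add_mk, smul_eq_mul]
    field_simp
    ring

theorem dForm_slope (h1 : chartPoint M z 1 ≠ 0) :
    dForm (chartSlope M) z = (chartPoint M z 1 ^ 2)⁻¹ • pencilForm M z :=
  dForm_chartPoint_div h1 0

theorem dlogIntercept_eq (h1 : chartPoint M z 1 ≠ 0) (h2 : chartPoint M z 2 ≠ 0) :
    dlogIntercept M z = (chartPoint M z 1 * chartPoint M z 2)⁻¹ •
      (chartPoint M z 1 * M 2 0 - chartPoint M z 2 * M 1 0,
        chartPoint M z 1 * M 2 1 - chartPoint M z 2 * M 1 1) := by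
  have : dForm (intercept M) z = _ := dForm_chartPoint_div h1 2
  rw [dlogIntercept, this, intercept, smul_smul]
  congr 1
  field_simp

theorem analyticAt_slope (h1 : chartPoint M z 1 ≠ 0) : AnalyticAt ℂ (chartSlope M) z :=
  (analyticAt_chartPoint M z 0).mul ((analyticAt_chartPoint M z 1).inv h1)

theorem analyticAt_intercept (h1 : chartPoint M z 1 ≠ 0) : AnalyticAt ℂ (intercept M) z :=
  (analyticAt_chartPoint M z 2).mul ((analyticAt_chartPoint M z 1).inv h1)

theorem intercept_ne_zero (h1 : chartPoint M z 1 ≠ 0) (h2 : chartPoint M z 2 ≠ 0) :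
    intercept M z ≠ 0 :=
  mul_ne_zero h2 (inv_ne_zero h1)

theorem analyticAt_dlogIntercept (h1 : chartPoint M z 1 ≠ 0) (h2 : chartPoint M z 2 ≠ 0) :
    AnalyticAt ℂ (dlogIntercept M) z :=
  ((analyticAt_intercept h1).inv (intercept_ne_zero h1 h2)).smul (analyticAt_intercept h1).dForm

theorem eventually_chartPoint_ne_zero {i : Fin 3} (hi : chartPoint M z i ≠ 0) :
    ∀ᶠ w in 𝓝 z, chartPoint M w i ≠ 0 :=
  (analyticAt_chartPoint M z i).continuousAt.eventually_ne hi

/-- The wedge is det M up to nonvanishing factors; thus θ and α form a basis of covectors wherever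
both are defined. -/
theorem wedge_dlogIntercept_dForm_slope (hM : M.det ≠ 0) (h1 : chartPoint M z 1 ≠ 0)
    (h2 : chartPoint M z 2 ≠ 0) : wedge (dlogIntercept M z) (dForm (chartSlope M) z) ≠ 0 := by
  have key : wedge (dlogIntercept M z) (dForm (chartSlope M) z) =
      (chartPoint M z 1 * chartPoint M z 2)⁻¹ * (chartPoint M z 1 ^ 2)⁻¹ *
        (chartPoint M z 1 * M.det) := by
    rw [dlogIntercept_eq h1 h2, dForm_slope h1]
    generalize (chartPoint M z 1 * chartPoint M z 2)⁻¹ = c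
    generalize (chartPoint M z 1 ^ 2)⁻¹ = c'
    simp only [wedge, pencilForm, Prod.smul_fst, Prod.smul_snd, smul_eq_mul, chartPoint_apply,
      Matrix.det_fin_three]
    ring
  rw [key]
  exact mul_ne_zero (mul_ne_zero (inv_ne_zero (mul_ne_zero h1 h2)) (inv_ne_zero (pow_ne_zero _ h1)))
    (mul_ne_zero h1 hM)

theorem wedge_dForm_slope_ne_zero (h1 : chartPoint M z 1 ≠ 0) {a : ℂ × ℂ}
    (h : wedge a (pencilForm M z) ≠ 0) : wedge (dForm (chartSlope M) z) a ≠ 0 := by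
  rw [dForm_slope h1]
  have : wedge ((chartPoint M z 1 ^ 2)⁻¹ • pencilForm M z) a =
      -((chartPoint M z 1 ^ 2)⁻¹ * wedge a (pencilForm M z)) := by
    simp only [wedge, Prod.smul_fst, Prod.smul_snd, smul_eq_mul]; ring
  rw [this]
  exact neg_ne_zero.2 (mul_ne_zero (inv_ne_zero (pow_ne_zero _ h1)) h)

theorem analyticAt_abscissa {ω : ℂ × ℂ → ℂ × ℂ} (hω : AnalyticAt ℂ ω z)
    (h1 : chartPoint M z 1 ≠ 0) (h2 : chartPoint M z 2 ≠ 0)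
    (h : wedge (ω z) (pencilForm M z) ≠ 0) : AnalyticAt ℂ (abscissa M ω) z :=
  ((analyticAt_dlogIntercept h1 h2).wedge hω).div ((analyticAt_slope h1).dForm.wedge hω)
    (wedge_dForm_slope_ne_zero h1 h)

/-- The abscissa can be computed from any vector in the kernel. -/
theorem abscissa_eq {ω : ℂ × ℂ → ℂ × ℂ} {v : ℂ × ℂ} (h1 : chartPoint M z 1 ≠ 0)
    (h : wedge (ω z) (pencilForm M z) ≠ 0) (hv : (ω z).1 * v.1 + (ω z).2 * v.2 = 0)
    (hσ : (dForm (chartSlope M) z).1 * v.1 + (dForm (chartSlope M) z).2 * v.2 ≠ 0) :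
    abscissa M ω z = ((dlogIntercept M z).1 * v.1 + (dlogIntercept M z).2 * v.2) /
      ((dForm (chartSlope M) z).1 * v.1 + (dForm (chartSlope M) z).2 * v.2) := by
  rw [abscissa, div_eq_div_iff (wedge_dForm_slope_ne_zero h1 h) hσ]
  simp only [wedge]
  linear_combination ((dlogIntercept M z).1 * (dForm (chartSlope M) z).2 -
    (dlogIntercept M z).2 * (dForm (chartSlope M) z).1) * hv

variable {n : ℕ} {F : PlaneFoliation n} {g : GL (Fin 3) ℂ}

/-- The abscissae of the tangency points of a homogeneous foliation with a line only depend on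
the slope of the line. -/
theorem PlaneFoliation.IsHomogeneousIn.chartTangent_iff (hF : F.IsHomogeneousIn g)
    (h1 : chartPoint M z 1 ≠ 0) (h2 : chartPoint M z 2 ≠ 0) {v : ℂ × ℂ}
    (hσ : (dForm (chartSlope M) z).1 * v.1 + (dForm (chartSlope M) z).2 * v.2 ≠ 0) :
    ChartTangent F g M z v ↔ F.Tangent (g.1ᵀ *ᵥ ![chartSlope M z, 1, 1])
      (g.1ᵀ *ᵥ ![1, 0, ((dlogIntercept M z).1 * v.1 + (dlogIntercept M z).2 * v.2) /
        ((dForm (chartSlope M) z).1 * v.1 + (dForm (chartSlope M) z).2 * v.2)]) := by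
  have e1 : (dForm (chartSlope M) z).1 * v.1 + (dForm (chartSlope M) z).2 * v.2 =
      (chartPoint M z 1 ^ 2)⁻¹ * (chartPoint M z 1 * chartDir M v 0 -
        chartPoint M z 0 * chartDir M v 1) := by
    rw [dForm_slope h1, ← pairing_pencilForm]
    simp only [Prod.smul_fst, Prod.smul_snd, smul_eq_mul]
    ring
  have e2 : (dlogIntercept M z).1 * v.1 + (dlogIntercept M z).2 * v.2 =
      (chartPoint M z 1 * chartPoint M z 2)⁻¹ * (chartPoint M z 1 * chartDir M v 2 -
        chartPoint M z 2 * chartDir M v 1) := by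
    rw [dlogIntercept_eq h1 h2]
    simp only [Prod.smul_fst, Prod.smul_snd, smul_eq_mul, chartDir_apply]
    ring
  have hm := right_ne_zero_of_mul (e1 ▸ hσ)
  rw [ChartTangent, hF.tangent_iff_normalized h1 h2 hm, e1, e2, chartSlope, div_eq_mul_inv]
  have : chartPoint M z 1 * (chartPoint M z 1 * chartDir M v 2 - chartPoint M z 2 * chartDir M v 1) /
      (chartPoint M z 2 * (chartPoint M z 1 * chartDir M v 0 - chartPoint M z 0 * chartDir M v 1)) =
      (chartPoint M z 1 * chartPoint M z 2)⁻¹ *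
        (chartPoint M z 1 * chartDir M v 2 - chartPoint M z 2 * chartDir M v 1) /
      ((chartPoint M z 1 ^ 2)⁻¹ *
        (chartPoint M z 1 * chartDir M v 0 - chartPoint M z 0 * chartDir M v 1)) := by
    field_simp
  rw [this]

/-- The leaves of the pencil are straight lines in the chart, so constancy along them can be tested
on affine segments. -/
theorem slope_add_smul {v : ℂ × ℂ} {c : ℂ} (h1 : chartPoint M z 1 ≠ 0)
    (hv : (pencilForm M z).1 * v.1 + (pencilForm M z).2 * v.2 = 0)
    (h1' : chartPoint M (z + c • v) 1 ≠ 0) : chartSlope M (z + c • v) = chartSlope M z := by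
  rw [pairing_pencilForm] at hv
  have e : ∀ i, chartPoint M (z + c • v) i = chartPoint M z i + c * chartDir M v i := by
    intro i
    simp only [chartPoint_apply, chartDir_apply, Prod.fst_add, Prod.snd_add, Prod.smul_fst,
      Prod.smul_snd, smul_eq_mul]
    ring
  rw [chartSlope, chartSlope, ← div_eq_mul_inv, ← div_eq_mul_inv, div_eq_div_iff h1' h1, e, e]
  linear_combination c * hv

/-- The abscissae are constant along the pencil. -/
theorem wedge_dForm_abscissa (hF : F.IsHomogeneousIn g) (hM : M.det ≠ 0) {m : ℕ}
    {V : Set (ℂ × ℂ)} {ω : Fin m → ℂ × ℂ → ℂ × ℂ}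
    (hω : IsDecomposition m (dualWeb F g M) V ω) (hz : z ∈ V)
    (h1 : chartPoint M z 1 ≠ 0) (h2 : chartPoint M z 2 ≠ 0)
    (ht : ∀ i, wedge (ω i z) (pencilForm M z) ≠ 0) (i : Fin m) :
    wedge (dForm (abscissa M (ω i)) z) (dForm (chartSlope M) z) = 0 := by
  -- `e` is tangent to the pencil, and dξ ∧ dσ is the derivative of ξ in the direction `e`.
  set e := kerVec (dForm (chartSlope M) z) with he
  have hpe : (pencilForm M z).1 * e.1 + (pencilForm M z).2 * e.2 = 0 := by
    rw [he, pairing_kerVec, dForm_slope h1]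
    simp only [wedge, Prod.smul_fst, Prod.smul_snd, smul_eq_mul]
    ring
  have han := analyticAt_abscissa (hω.analytic i z hz) h1 h2 (ht i)
  rw [← pairing_kerVec, ← he, ← fderiv_apply_eq_dForm, ← han.differentiableAt.lineDeriv_eq_fderiv,
    lineDeriv]
  have hγ : Tendsto (fun c : ℂ => z + c • e) (𝓝 0) (𝓝 z) := by
    have : Continuous fun c : ℂ => z + c • e := by fun_prop
    simpa using this.tendsto 0
  have hcont : ContinuousAt (fun c : ℂ => abscissa M (ω i) (z + c • e)) 0 := by
    have := han.continuousAt.tendsto.comp hγ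
    simpa [ContinuousAt, Function.comp_def] using this
  -- Along the pencil the slope is fixed, and the tangency condition involves only the slope and ξ.
  -- Hence each abscissa at a nearby line is already one of the finitely many abscissae at `z`.
  have hmem : ∀ᶠ c : ℂ in 𝓝 0, abscissa M (ω i) (z + c • e) ∈
      Set.range fun j => abscissa M (ω j) z := by
    have hgood : ∀ᶠ w in 𝓝 z, w ∈ V ∧ chartPoint M w 1 ≠ 0 ∧ chartPoint M w 2 ≠ 0 ∧
        wedge (ω i w) (pencilForm M w) ≠ 0 :=
      (hω.isOpen.eventually_mem hz).and ((eventually_chartPoint_ne_zero h1).and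
        ((eventually_chartPoint_ne_zero h2).and
          (((hω.analytic i z hz).wedge (analyticAt_pencilForm M z)).continuousAt.eventually_ne
            (ht i))))
    filter_upwards [hγ.eventually hgood] with c hc
    obtain ⟨hcV, hc1, hc2, hct⟩ := hc
    set w := z + c • e
    have hw0 := hω.ne_zero i w hcV
    -- the tangency point at the nearby line
    have hσw : (dForm (chartSlope M) w).1 * (kerVec (ω i w)).1 +
        (dForm (chartSlope M) w).2 * (kerVec (ω i w)).2 ≠ 0 := by
      rw [pairing_kerVec]
      exact wedge_dForm_slope_ne_zero hc1 hct
    have hkw : (ω i w).1 * (kerVec (ω i w)).1 + (ω i w).2 * (kerVec (ω i w)).2 = 0 := by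
      rw [pairing_kerVec]; simp only [wedge]; ring
    have hTw := ((hω.directions w hcV _ (kerVec_ne_zero hw0)).2 ⟨i, hkw⟩).2
    rw [hF.chartTangent_iff hc1 hc2 hσw, ← abscissa_eq hc1 hct hkw hσw,
      slope_add_smul h1 hpe hc1] at hTw
    -- the corresponding direction at the line `z`
    set ξ := abscissa M (ω i) w
    have hD := wedge_dlogIntercept_dForm_slope hM h1 h2
    set θ := dlogIntercept M z with hθ
    set α := dForm (chartSlope M) z with hα
    -- The solution of α(v) = 1, θ(v) = ξ by Cramer's rule.
    set v : ℂ × ℂ := ((ξ * α.2 - θ.2) / wedge θ α, (θ.1 - ξ * α.1) / wedge θ α) with hv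
    have hαv : α.1 * v.1 + α.2 * v.2 = 1 := by
      simp only [hv]
      field_simp
      simp only [wedge]; ring
    have hθv : θ.1 * v.1 + θ.2 * v.2 = ξ := by
      simp only [hv]
      field_simp
      simp only [wedge]; ring
    have hv0 : v ≠ 0 := by
      intro h0
      rw [h0] at hαv
      simp at hαv
    have hαv0 : (dForm (chartSlope M) z).1 * v.1 + (dForm (chartSlope M) z).2 * v.2 ≠ 0 := by
      rw [← hα, hαv]; exact one_ne_zero
    have hTz : ChartTangent F g M z v := by
      rw [hF.chartTangent_iff h1 h2 hαv0, ← hα, ← hθ, hαv, hθv, div_one]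
      exact hTw
    obtain ⟨j, hj⟩ := (hω.directions z hz v hv0).1 ⟨hv0, hTz⟩
    refine ⟨j, ?_⟩
    change abscissa M (ω j) z = ξ
    rw [abscissa_eq h1 (ht j) hj hαv0, ← hα, ← hθ, hαv, hθv, div_one]
  have hconst := eventually_eq_of_mem_finite hcont (Set.finite_range _) hmem
  rw [EventuallyEq.deriv_eq (f := fun _ : ℂ => abscissa M (ω i) (z + (0 : ℂ) • e)) hconst,
    deriv_const]

/-- The `3`-webs made of the pencil and of two foliations of the dual web of a homogeneous
foliation are flat. -/
theorem extDer_fundForm_pencil (hF : F.IsHomogeneousIn g) (hM : M.det ≠ 0) {m : ℕ}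
    {V : Set (ℂ × ℂ)} {ω : Fin m → ℂ × ℂ → ℂ × ℂ}
    (hω : IsDecomposition m (dualWeb F g M) V ω) (hz : z ∈ V)
    (h1 : chartPoint M z 1 ≠ 0) (h2 : chartPoint M z 2 ≠ 0)
    (ht : ∀ w ∈ V, ∀ i, wedge (ω i w) (pencilForm M w) ≠ 0) {i j : Fin m}
    {β : ℂ × ℂ → ℂ × ℂ} (hβ : ∀ w ∈ V, wedge (β w) (pencilForm M w) = 0)
    (htriple : IsTransverseTriple (ω i) (ω j) β z) :
    extDer (fundForm (ω i) (ω j) β) z = 0 := by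
  have hgood : ∀ᶠ w in 𝓝 z, w ∈ V ∧ chartPoint M w 1 ≠ 0 ∧ chartPoint M w 2 ≠ 0 :=
    (hω.isOpen.eventually_mem hz).and ((eventually_chartPoint_ne_zero h1).and
      (eventually_chartPoint_ne_zero h2))
  have haθ := analyticAt_dlogIntercept h1 h2
  have haα := (analyticAt_slope h1).dForm
  have hD := wedge_dlogIntercept_dForm_slope hM h1 h2
  have hβ0 : β z ≠ 0 := by
    intro h0
    apply htriple.ne₂₃
    simp [h0, wedge]
  have hα0 : dForm (chartSlope M) z ≠ 0 := by
    intro h0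
    apply hD
    simp [h0, wedge]
  obtain ⟨f, haf, hf0, hf⟩ := exists_factor_of_wedge_eq_zero haα htriple.an₃ hα0 hβ0 (by
    filter_upwards [hgood] with w hw
    have := hβ w hw.1
    rw [dForm_slope hw.2.1]
    simp only [wedge, Prod.smul_fst, Prod.smul_snd, smul_eq_mul] at this ⊢
    linear_combination -(chartPoint M w 1 ^ 2)⁻¹ * this)
  -- The expansion of `ω k` in the basis θ, α; by the definition of `abscissa`, `ω k` is
  -- proportional to θ - ξ α.
  have decomp : ∀ k, ∀ᶠ w in 𝓝 z, ω k w =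
      (wedge (ω k w) (dForm (chartSlope M) w) / wedge (dlogIntercept M w) (dForm (chartSlope M) w)) •
        (dlogIntercept M w + (-abscissa M (ω k) w) • dForm (chartSlope M) w) := by
    intro k
    filter_upwards [hgood] with w hw
    have hDw := wedge_dlogIntercept_dForm_slope hM hw.2.1 hw.2.2
    have hk := wedge_dForm_slope_ne_zero hw.2.1 (ht w hw.1 k)
    refine eq_of_wedge_eq hDw ?_ ?_
    · rw [abscissa]
      set θ := dlogIntercept M w
      set α := dForm (chartSlope M) w
      have : wedge ((wedge (ω k w) α / wedge θ α) •
          (θ + (-(wedge θ (ω k w) / wedge α (ω k w))) • α)) θ =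
          wedge (ω k w) α / wedge θ α * (-(wedge θ (ω k w) / wedge α (ω k w))) * wedge α θ := by
        simp only [wedge, Prod.smul_fst, Prod.smul_snd, smul_eq_mul, Prod.fst_add, Prod.snd_add]
        ring
      rw [this, wedge_comm (ω k w) α, wedge_comm (ω k w) θ, wedge_comm α θ]
      field_simp
    · set θ := dlogIntercept M w
      set α := dForm (chartSlope M) w
      have : wedge ((wedge (ω k w) α / wedge θ α) • (θ + (-abscissa M (ω k) w) • α)) α =
          wedge (ω k w) α / wedge θ α * wedge θ α := by
        simp only [wedge, Prod.smul_fst, Prod.smul_snd, smul_eq_mul, Prod.fst_add, Prod.snd_add]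
        ring
      rw [this]
      field_simp
  have hau : ∀ k, AnalyticAt ℂ (fun w => wedge (ω k w) (dForm (chartSlope M) w) /
      wedge (dlogIntercept M w) (dForm (chartSlope M) w)) z := fun k =>
    ((hω.analytic k z hz).wedge haα).div (haθ.wedge haα) hD
  have hu0 : ∀ k, wedge (ω k z) (dForm (chartSlope M) z) /
      wedge (dlogIntercept M z) (dForm (chartSlope M) z) ≠ 0 := fun k =>
    div_ne_zero (wedge_ne_zero_symm (wedge_dForm_slope_ne_zero h1 (ht z hz k))) hD
  have hξ : ∀ k, AnalyticAt ℂ (abscissa M (ω k)) z := fun k =>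
    analyticAt_abscissa (hω.analytic k z hz) h1 h2 (ht z hz k)
  have hdξ : ∀ k, ∀ᶠ w in 𝓝 z, wedge (dForm (abscissa M (ω k)) w) (dForm (chartSlope M) w) = 0 := by
    intro k
    filter_upwards [hgood] with w hw
    exact wedge_dForm_abscissa hF hM hω hw.1 hw.2.1 hw.2.2 (ht w hw.1) k
  refine extDer_fundForm_eq_zero htriple haθ haα (hau i) (hau j) haf (hξ i) (hξ j) (hu0 i) (hu0 j)
    hf0 hD (decomp i) (decomp j) hf ?_ ?_ (hdξ i) (hdξ j)
  · filter_upwards [hgood] with w hw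
    exact extDer_dlog (analyticAt_intercept hw.2.1) (intercept_ne_zero hw.2.1 hw.2.2)
  · filter_upwards [hgood] with w hw
    exact extDer_dForm (analyticAt_slope hw.2.1)

/-- The lines at which a general position argument applies are dense. -/
theorem dense_generic (F : PlaneFoliation n) (g : GL (Fin 3) ℂ) (hM : M.det ≠ 0) :
    Dense {z : ℂ × ℂ | chartPoint M z 1 ≠ 0 ∧ chartPoint M z 2 ≠ 0 ∧
      ∀ v, v ≠ 0 → (pencilForm M z).1 * v.1 + (pencilForm M z).2 * v.2 = 0 →
        ¬ChartTangent F g M z v} := by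
  obtain ⟨p, hp, hhom, hgen⟩ := F.exists_polynomial_not_tangent g
  refine (dense_eval_chartPoint_ne_zero hM hp hhom).mono fun z hz => ?_
  obtain ⟨h1, h2, ht⟩ := hgen _ hz
  refine ⟨h1, h2, fun v hv hpv => ht _ ?_ ?_⟩
  · rwa [pairing_pencilForm] at hpv
  · intro hcross
    -- If v ≠ 0, the vectors of the line z and of the direction v are independent, since M is
    -- invertible and the chart directions have last coordinate 0.
    have hcr : ∀ x, chartPoint M z ⬝ᵥ chartDir M v ⨯₃ chartDir M x = 0 := by
      intro x
      rw [triple_product_permutation, triple_product_permutation, hcross, dotProduct_zero]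
    have key : ∀ x : ℂ × ℂ, v.1 * x.2 - v.2 * x.1 = 0 := by
      intro x
      have := hcr x
      rw [chartPoint, chartDir, chartDir, triple_product_mulVec] at this
      have h0 := (mul_eq_zero.1 this).resolve_left hM
      simpa [cross_apply] using h0
    refine hv (Prod.ext ?_ ?_)
    · simpa using key (0, 1)
    · simpa using key (1, 0)

theorem pencilForm_ne_zero (hM : M.det ≠ 0) (h1 : chartPoint M z 1 ≠ 0)
    (h2 : chartPoint M z 2 ≠ 0) : pencilForm M z ≠ 0 := by
  intro h
  apply wedge_dlogIntercept_dForm_slope hM h1 h2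
  rw [dForm_slope h1, h]
  simp [wedge]

/-- Regular points of the web of `L_∞ ⊠ F` are dense among regular points of the web of `F`. -/
theorem IsDecomposition.dense_regular (hM : M.det ≠ 0) {U : Set (ℂ × ℂ)}
    {ω : Fin n → ℂ × ℂ → ℂ × ℂ} (hω : IsDecomposition n (dualWeb F g M) U ω) :
    U ⊆ closure {w | w ∈ U ∧ IsRegularPoint (n + 1) (boxDualWeb F g M) w} := by
  intro z hz
  refine closure_mono ?_ ((dense_generic F g hM).open_subset_closure_inter hω.isOpen hz)
  rintro w ⟨hw, h1, h2, ht⟩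
  refine ⟨hw, hω.isRegularPoint_boxDualWeb hw (pencilForm_ne_zero hM h1 h2) fun i hi => ?_⟩
  have hp := pencilForm_ne_zero hM h1 h2
  refine ht _ (kerVec_ne_zero hp) (by simp only [kerVec]; ring)
    ((hω.kerVec_mem_iff hw hp).2 ⟨i, hi⟩).2

/-- The pencil of the line at infinity does not contribute to the curvature. -/
theorem curvature_boxDualWeb (hF : F.IsHomogeneousIn g) (hM : M.det ≠ 0)
    (hz : IsRegularPoint (n + 1) (boxDualWeb F g M) z) :
    IsRegularPoint n (dualWeb F g M) z ∧
      webCurvature (n + 1) (boxDualWeb F g M) z = webCurvature n (dualWeb F g M) z := by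
  obtain ⟨U, ω, hzU, hω⟩ := hz
  obtain ⟨k, V, hVU, hzV, hk, ht, hV⟩ := hω.exists_removePencil hM hzU
  have hωV := hω.mono hV.isOpen hVU
  refine ⟨⟨V, _, hzV, hV⟩, ?_⟩
  rw [hωV.webCurvature_eq hzV, hV.webCurvature_eq hzV]
  -- Where slope and logarithmic intercept are defined, the triples containing `k` have zero
  -- curvature; permutation invariance lets the pencil be placed last.
  have heq : ∀ w ∈ V, chartPoint M w 1 ≠ 0 → chartPoint M w 2 ≠ 0 →
      curvatureOf ω w = curvatureOf (fun i => ω (k.succAbove i)) w := by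
    intro w hw h1 h2
    have hflat : ∀ r s : Fin (n + 1), r ≠ s → r ≠ k → s ≠ k →
        extDer (fundForm (ω r) (ω s) (ω k)) w = 0 := by
      intro r s hrs hr hs
      have htr := hωV.triple hw hrs hs hr
      obtain ⟨r, rfl⟩ := Fin.exists_succAbove_eq hr
      obtain ⟨s, rfl⟩ := Fin.exists_succAbove_eq hs
      exact extDer_fundForm_pencil hF hM hV hw h1 h2 ht hk htr
    refine curvatureOf_succAbove ω k fun r s t hrs hst hor => ?_
    have hrt := hrs.trans hst
    rcases hor with rfl | rfl | rfl
    · rw [← (hωV.triple hw hrs.ne hst.ne hrt.ne).extDer_fundForm_cycle]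
      exact hflat s t hst.ne hrs.ne' hrt.ne'
    · rw [(hωV.triple hw hrt.ne' hrs.ne hst.ne').extDer_fundForm_cycle]
      exact hflat t r hrt.ne' hst.ne' hrs.ne
    · exact hflat r s hrs.ne hrt.ne hst.ne
  -- Vertical lines and lines through the origin are limits of lines already treated, and both
  -- curvatures are continuous on `V`.
  have hcl : z ∈ closure (V ∩ {w | chartPoint M w 1 ≠ 0 ∧ chartPoint M w 2 ≠ 0}) := by
    refine closure_mono ?_ ((dense_generic F g hM).open_subset_closure_inter hV.isOpen hzV)
    rintro w ⟨hw, h1, h2, -⟩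
    exact ⟨hw, h1, h2⟩
  have hc1 := (hωV.continuousOn_curvatureOf).continuousAt (hV.isOpen.mem_nhds hzV)
  have hc2 := (hV.continuousOn_curvatureOf).continuousAt (hV.isOpen.mem_nhds hzV)
  exact eq_of_mem_closure hc1 hc2 hcl fun w hw => heq w hw.1 hw.2.1 hw.2.2

end Chart

/-! ### Transfer to the Legendre transforms and conclusion -/

theorem curvature_lineAtInfinityBox {n : ℕ} {H : PlaneFoliation n} {g : GL (Fin 3) ℂ}
    (hH : H.IsHomogeneousIn g) (h : GL (Fin 3) ℂ) (z : ℂ × ℂ)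
    (hz : (H.lineAtInfinityBox g).LegRegularAt h z) :
    H.toPre.LegRegularAt h z ∧
      (H.lineAtInfinityBox g).legCurvature h z = H.toPre.legCurvature h z := by
  unfold PlanePreFoliation.LegRegularAt PlanePreFoliation.legCurvature at *
  rw [leg_lineAtInfinityBox, Nat.add_comm 1 n] at *
  rw [leg_toPre H g, Nat.zero_add]
  exact curvature_boxDualWeb hH (det_chartMatrix_ne_zero g h) hz

/-- A regular point of `Leg H` may lie on the discriminant of the larger web, so equality of
curvatures gives vanishing only on a dense subset; continuity extends it. -/
theorem legFlat_of_lineAtInfinityBox {n : ℕ} {H : PlaneFoliation n} {g : GL (Fin 3) ℂ}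
    (hH : H.IsHomogeneousIn g) (hflat : (H.lineAtInfinityBox g).LegFlat) : H.toPre.LegFlat := by
  intro h z hz
  have hM := det_chartMatrix_ne_zero g h
  have hbox : ∀ w, IsRegularPoint (n + 1) (boxDualWeb H g (chartMatrix g h)) w →
      webCurvature (n + 1) (boxDualWeb H g (chartMatrix g h)) w = 0 := by
    intro w hw
    have := hflat h w
    unfold PlanePreFoliation.LegRegularAt PlanePreFoliation.legCurvature at this
    rw [leg_lineAtInfinityBox, Nat.add_comm 1 n] at this
    exact this hw
  unfold PlanePreFoliation.LegRegularAt at hz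
  unfold PlanePreFoliation.legCurvature
  rw [leg_toPre H g, Nat.zero_add] at *
  obtain ⟨U, ω, hzU, hω⟩ := hz
  rw [hω.webCurvature_eq hzU]
  have hc := hω.continuousOn_curvatureOf.continuousAt (hω.isOpen.mem_nhds hzU)
  refine eq_of_mem_closure hc continuousAt_const (hω.dense_regular hM hzU) fun w hw => ?_
  rw [← hω.webCurvature_eq hw.1, ← (curvature_boxDualWeb hH hM hw.2).2, hbox w hw.2]

/-- The curvature of a `2`-web vanishes. -/
theorem legFlat_toPre_of_degree_two (H : PlaneFoliation 2) : H.toPre.LegFlat := by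
  rintro h z ⟨U, ω, hz, hω⟩
  rw [PlanePreFoliation.legCurvature, hω.webCurvature_eq hz]
  -- Two foliations contain no triple r < s < t, so the sum is empty.
  refine Finset.sum_eq_zero fun r _ => Finset.sum_eq_zero fun s _ =>
    Finset.sum_eq_zero fun t _ => if_neg ?_
  omega

end

theorem mainTheorem8 (n : ℕ) (hn : 2 ≤ n) (H : PlaneFoliation n) (g : GL (Fin 3) ℂ)
    (hH : H.IsHomogeneousIn g) :
    SameLegCurvature (H.lineAtInfinityBox g) H.toPre ∧
    ((H.lineAtInfinityBox g).LegFlat ↔ H.toPre.LegFlat) ∧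
    (n = 2 → (H.lineAtInfinityBox g).LegFlat) := by
  have key := curvature_lineAtInfinityBox hH
  have hflat : H.toPre.LegFlat → (H.lineAtInfinityBox g).LegFlat := fun hf h z hz =>
    (key h z hz).2.trans (hf h z (key h z hz).1)
  refine ⟨fun h z hz _ => (key h z hz).2, ⟨legFlat_of_lineAtInfinityBox hH, hflat⟩, ?_⟩
  rintro rfl
  exact hflat (legFlat_toPre_of_degree_two H)
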